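/- Let $\mathbb{F}_q$ be a finite field with $q$ elements, $C$ a smooth projective geometrically irreducible curve over $\mathbb{F}_q$, $\infty\in C(\mathbb{F}_q)$ a rational point and $A=\Gamma(C\setminus\{\infty\},\mathcal{O}_C)$. Let $L$ be a field extension of $\mathbb{F}_q$ and $c^*:A\to L$ a homomorphism of $\mathbb{F}_q$-algebras. Put $A_L=A\otimes_{\mathbb{F}_q}L$, let $\sigma$ denote the endomorphism $a\otimes b\mapsto a\otimes b^q$ of $A_L$ and the endomorphism of $C_L=C\times_{\mathbb{F}_q}L$ that it comes from, write $\sigma^*M=M\otimes_{A_L,\sigma}A_L$, and let $J\subset A_L$ be the ideal generated by the elements $a\otimes 1-1\otimes c^*(a)$, $a\in A$. A *pure Anderson motive* $\underline{M}=(M,\tau)$ of rank $r\ge 0$, dimension $d\ge 0$ and characteristic $c^*$ over $L$ consists of a locally free $A_L$-module $M$ of rank $r$ and an injective $A_L$-homomorphism $\tau:\sigma^*M\to M$ such that $\operatorname{coker}\tau$ is an $L$-vector space of dimension $d$ annihilated by $J^d$, and such that $M$ extends to a locally free sheaf $\mathcal{M}$ of rank $r$ on $C_L$ for which, for some positive integers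 $k,l$, the map $\tau^l=\tau\circ\sigma^*\tau\circ\dots\circ(\sigma^{*})^{l-1}\tau$ induces an isomorphism of stalks $((\sigma^*)^l\mathcal{M})_\infty\to\mathcal{M}(k\cdot\infty)_\infty$. A morphism $f:(M,\tau)\to(M',\tau')$ of pure Anderson motives of the same characteristic is an $A_L$-homomorphism $f:M\to M'$ with $f\circ\tau=\tau'\circ\sigma^*f$. It is an *isogeny* if it is injective with torsion cokernel, and a *separable isogeny* if moreover the homomorphism $\sigma^*\operatorname{coker}f\to\operatorname{coker}f$ induced by $\tau'$ is an isomorphism. **Theorem.** 1. If $L$ is finite, then the relation "there is a separable isogeny $\underline{M}\to\underline{M}'$" on the pure Anderson motives of characteristic $c^*$ over $L$ is an equivalence relation; in particular it is symmetric. 2. This fails over infinite fields: for every finite field $\mathbb{F}_q$ let $C=\mathbb{P}^1_{\mathbb{F}_q}$ with its usual point $\infty$, $A=\mathbb{F}_q[t]$, $L=\mathbb{F}_q(\gamma)$ with $\gamma$ transcendental over $\mathbb{F}_q$, and $c^*:A\to L$, $t\mapsto 0$. Then there are pure Anderson motives $\underline{M}'$, $\underline{M}$ of characteristic $c^*$ over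 $L$ such that there is a separable isogeny $\underline{M}'\to\underline{M}$ but no separable isogeny $\underline{M}\to\underline{M}'$. -/

import Mathlib

open scoped TensorProduct

universe u

noncomputable section

/-! ## Pull-back of modules along a ring endomorphism -/

section Pullback

variable {R : Type*} [CommRing R] (σ : R →+* R)

/-- The ring `R`, considered as an `R`-algebra through the endomorphism `σ`. -/
def Twisted (_σ : R →+* R) : Type _ := R

instance : CommRing (Twisted σ) := inferInstanceAs (CommRing R)

instance : Algebra R (Twisted σ) := RingHom.toAlgebra (S := Twisted σ) σ

/-- The identity map, from `R` to the ring underlying `Twisted σ`. -/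
def Twisted.of : R →+* Twisted σ := RingHom.id R

variable (M : Type*) [AddCommGroup M] [Module R M]

/-- `σ^* M`, the base change of the `R`-module `M` along `σ : R → R`. -/
def Pullback : Type _ := Twisted σ ⊗[R] M

instance : AddCommGroup (Pullback σ M) := inferInstanceAs (AddCommGroup (Twisted σ ⊗[R] M))

/-- `R` acts on `σ^* M` through the left factor: `s • (a ⊗ m) = (s * a) ⊗ m`. -/
instance : Module R (Pullback σ M) :=
  letI : Module (Twisted σ) (Pullback σ M) :=
    inferInstanceAs (Module (Twisted σ) (Twisted σ ⊗[R] M))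
  Module.compHom (Pullback σ M) (Twisted.of σ)

variable {M}

/-- The pure tensor `a ⊗ m` in `σ^* M`. -/
def Pullback.tmul (a : R) (m : M) : Pullback σ M := (Twisted.of σ a) ⊗ₜ[R] m

theorem Pullback.smul_tmul (s a : R) (m : M) :
    s • Pullback.tmul σ a m = Pullback.tmul σ (s * a) m := rfl

theorem Pullback.tmul_smul (a r : R) (m : M) :
    Pullback.tmul σ a (r • m) = Pullback.tmul σ (σ r * a) m :=
  (TensorProduct.smul_tmul r (Twisted.of σ a) m).symm

theorem Pullback.induction {p : Pullback σ M → Prop} (h0 : p 0)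
    (ht : ∀ a m, p (Pullback.tmul σ a m)) (ha : ∀ x y, p x → p y → p (x + y))
    (x : Pullback σ M) : p x :=
  TensorProduct.induction_on (motive := p) x h0 ht ha

/-- The canonical `σ`-semilinear map `m ↦ 1 ⊗ m`. -/
def Pullback.mk : M →ₛₗ[σ] Pullback σ M where
  toFun m := Pullback.tmul σ 1 m
  map_add' m n := TensorProduct.tmul_add _ m n
  map_smul' r m := by
    rw [Pullback.tmul_smul, Pullback.smul_tmul]

variable {N : Type*} [AddCommGroup N] [Module R N]

variable {σ}

/-- The additive map `σ^* M → N`, `a ⊗ m ↦ a • φ m`. -/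
def Pullback.liftAux (φ : M →ₛₗ[σ] N) : Pullback σ M →+ N :=
  TensorProduct.liftAddHom (R := R) (M := Twisted σ) (N := M)
    { toFun := fun a : R =>
        { toFun := fun m => a • φ m
          map_zero' := by simp
          map_add' := by simp }
      map_zero' := by ext m; exact zero_smul R (φ m)
      map_add' := fun a b => by ext m; exact add_smul (R := R) a b (φ m) }
    (by
      intro r a m
      change (id (σ r * (show R from a)) : R) • φ m = (show R from a) • φ (r • m)
      rw [map_smulₛₗ, smul_smul, mul_comm]; rfl)

/-- The `R`-linear map `σ^* M → N`, `a ⊗ m ↦ a • φ m`, that corresponds to a `σ`-semilinear map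
`φ : M → N`. -/
def Pullback.lift (φ : M →ₛₗ[σ] N) : Pullback σ M →ₗ[R] N where
  toFun := Pullback.liftAux φ
  map_add' := map_add _
  map_smul' s x := by
    induction x using Pullback.induction with
    | h0 => rw [smul_zero, map_zero, smul_zero]
    | ht a m => exact mul_smul s a (φ m)
    | ha x y hx hy => rw [smul_add, map_add, map_add, smul_add, hx, hy]

theorem Pullback.lift_tmul (φ : M →ₛₗ[σ] N) (a : R) (m : M) :
    Pullback.lift φ (Pullback.tmul σ a m) = a • φ m := rfl

/-- `σ^* f : σ^* M → σ^* N`, `a ⊗ m ↦ a ⊗ f m`. -/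
def Pullback.map (σ : R →+* R) (f : M →ₗ[R] N) : Pullback σ M →ₗ[R] Pullback σ N :=
  Pullback.lift ((Pullback.mk σ).comp f)

/-- The `l`-th iterate of a `σ`-semilinear endomorphism, as a `σ^l`-semilinear map. -/
def semilinearIterate (φ : M →ₛₗ[σ] M) (l : ℕ) : M →ₛₗ[σ ^ l] M where
  toFun := φ^[l]
  map_add' := by
    induction l with
    | zero => intro x y; rfl
    | succ l ih => intro x y; simp [Function.iterate_succ_apply', ih]
  map_smul' := by
    induction l with
    | zero => intro r x; rfl
    | succ l ih =>
      intro r x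
      rw [Function.iterate_succ_apply', ih, map_smulₛₗ, Function.iterate_succ_apply', pow_succ']
      rfl

/-- The `R`-linear map `(σ^l)^* N → M` induced by the `l`-th iterate of a `σ`-semilinear
endomorphism `φ` of `M`, for a submodule `N` of `M`. -/
def iterateOn (φ : M →ₛₗ[σ] M) (N : Submodule R M) (l : ℕ) : Pullback (σ ^ l) N →ₗ[R] M :=
  Pullback.lift ((semilinearIterate φ l).comp N.subtype)

/-- The extension of a `σ`-semilinear endomorphism `φ` of `M` to the base change `S ⊗ M` along
`R → S`, where `ρ` is an endomorphism of `S` that extends `σ`: `s ⊗ m ↦ ρ s ⊗ φ m`. -/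
def semilinearBaseChange {S : Type*} [CommRing S] [Algebra R S] (ρ : S →+* S)
    (h : ∀ r : R, ρ (algebraMap R S r) = algebraMap R S (σ r)) (φ : M →ₛₗ[σ] M) :
    (S ⊗[R] M) →ₛₗ[ρ] (S ⊗[R] M) where
  toFun := TensorProduct.liftAddHom (R := R)
    { toFun := fun s =>
        { toFun := fun m => ρ s ⊗ₜ[R] φ m
          map_zero' := by simp
          map_add' := by intro x y; simp [TensorProduct.tmul_add] }
      map_zero' := by ext m; simp
      map_add' := fun a b => by ext m; simp [TensorProduct.add_tmul] }
    (by
      intro r s m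
      change ρ (r • s) ⊗ₜ[R] φ m = ρ s ⊗ₜ[R] φ (r • m)
      rw [map_smulₛₗ φ, ← TensorProduct.smul_tmul, Algebra.smul_def, Algebra.smul_def, map_mul, h])
  map_add' := map_add _
  map_smul' s x := by
    induction x using TensorProduct.induction_on with
    | zero => simp
    | tmul f m =>
      change ρ (s * f) ⊗ₜ[R] φ m = (ρ s * ρ f) ⊗ₜ[R] φ m
      rw [map_mul]
    | add x y hx hy => rw [smul_add, map_add, map_add, smul_add, hx, hy]

theorem semilinearBaseChange_tmul {S : Type*} [CommRing S] [Algebra R S] (ρ : S →+* S)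
    (h : ∀ r : R, ρ (algebraMap R S r) = algebraMap R S (σ r)) (φ : M →ₛₗ[σ] M) (s : S) (m : M) :
    semilinearBaseChange ρ h φ (s ⊗ₜ[R] m) = ρ s ⊗ₜ[R] φ m := rfl

end Pullback

/-! ## Curves over a finite field with a rational point

A smooth projective geometrically irreducible curve `C` over the (perfect) field `Fq` is given by
its function field `Q`. The closed points of `C` are the places of `Q`, that is, the nontrivial
valuation rings of `Q` that contain `Fq`; the valuation ring of a closed point is the local ring
of `C` there. -/

/-- `Q` is the function field of a smooth projective geometrically irreducible curve over the
finite field `Fq`: it is finitely generated of transcendence degree one over `Fq`, and `Fq` is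
algebraically closed in `Q`. -/
structure IsCurveFunctionField (Fq Q : Type*) [Field Fq] [Field Q] [Algebra Fq Q] : Prop where
  fg : (⊤ : IntermediateField Fq Q).FG
  trdeg_eq_one : Algebra.trdeg Fq Q = 1
  algebraic_mem : ∀ x : Q, IsAlgebraic Fq x → x ∈ (algebraMap Fq Q).range

/-- The valuation ring `v` of `Q` is the local ring of a closed point of the curve. -/
def IsPlace (Fq : Type*) {Q : Type*} [Field Fq] [Field Q] [Algebra Fq Q]
    (v : ValuationSubring Q) : Prop :=
  v ≠ ⊤ ∧ ∀ a : Fq, algebraMap Fq Q a ∈ v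

/-- An `Fq`-rational point of the curve: a closed point with residue field `Fq`. -/
structure RationalPoint (Fq Q : Type*) [Field Fq] [Field Q] [Algebra Fq Q] where
  /-- The local ring of the curve at the point. -/
  valuationRing : ValuationSubring Q
  isPlace : IsPlace Fq valuationRing
  residue : ∀ x ∈ valuationRing, ∃ a : Fq, valuationRing.valuation (x - algebraMap Fq Q a) < 1

section Curve

variable {Fq Q : Type u} [Field Fq] [Fintype Fq] [Field Q] [Algebra Fq Q]

/-- The ring `A = Γ(C ∖ {∞}, 𝒪_C)` of the functions that are regular at every closed point other
than `∞`. -/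
def RationalPoint.affineRing (P : RationalPoint Fq Q) : Subalgebra Fq Q where
  carrier := {x | ∀ v : ValuationSubring Q, IsPlace Fq v → v ≠ P.valuationRing → x ∈ v}
  mul_mem' hx hy v hv hP := mul_mem (hx v hv hP) (hy v hv hP)
  add_mem' hx hy v hv hP := add_mem (hx v hv hP) (hy v hv hP)
  algebraMap_mem' a _ hv _ := hv.2 a

/-- The local ring of `C` at `∞`, as an `Fq`-algebra. -/
def RationalPoint.localRing (P : RationalPoint Fq Q) : Subalgebra Fq Q where
  carrier := {x | x ∈ P.valuationRing}
  mul_mem' hx hy := P.valuationRing.mul_mem _ _ hx hy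
  add_mem' hx hy := P.valuationRing.add_mem _ _ hx hy
  algebraMap_mem' a := P.isPlace.2 a

variable (L : Type u) [Field L] [Algebra Fq L]

/-- The endomorphism `σ` of `B ⊗ L`, `b ⊗ x ↦ b ⊗ x ^ q` with `q = #Fq`. -/
def frob (Fq L B : Type u) [Field Fq] [Fintype Fq] [Field L] [Algebra Fq L]
    [CommRing B] [Algebra Fq B] : B ⊗[Fq] L →+* B ⊗[Fq] L :=
  (Algebra.TensorProduct.map (AlgHom.id Fq B) (FiniteField.frobeniusAlgHom Fq L)).toRingHom

theorem frob_tmul (B : Type u) [CommRing B] [Algebra Fq B] (b : B) (x : L) :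
    frob Fq L B (b ⊗ₜ[Fq] x) = b ⊗ₜ[Fq] (x ^ Fintype.card Fq) := rfl

/-- For a field `Q`, `σ` maps non-zero-divisors of `Q ⊗ L` to non-zero-divisors. -/
theorem frob_nonZeroDivisors :
    nonZeroDivisors (Q ⊗[Fq] L) ≤ (nonZeroDivisors (Q ⊗[Fq] L)).comap (frob Fq L Q) := by
  set F : Q ⊗[Fq] L →ₐ[Fq] Q ⊗[Fq] L :=
    Algebra.TensorProduct.map (FiniteField.frobeniusAlgHom Fq Q) (AlgHom.id Fq L) with hF
  have hinj : Function.Injective F := by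
    have h := Module.Flat.rTensor_preserves_injective_linearMap (M := L)
      (FiniteField.frobeniusAlgHom Fq Q).toLinearMap (FiniteField.frobeniusAlgHom Fq Q).injective
    exact h
  have hcomp : ∀ x, F (frob Fq L Q x) = x ^ Fintype.card Fq := by
    have h : F.comp (Algebra.TensorProduct.map (AlgHom.id Fq Q)
        (FiniteField.frobeniusAlgHom Fq L)) = FiniteField.frobeniusAlgHom Fq (Q ⊗[Fq] L) := by
      ext x
      · simp [hF]
      · simp [hF]
    exact fun x => DFunLike.congr_fun h x
  intro a ha
  rw [Submonoid.mem_comap, mem_nonZeroDivisors_iff_right]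
  intro y hy
  have h1 : F y * a ^ Fintype.card Fq = 0 := by
    rw [← hcomp, ← map_mul, hy, map_zero]
  have h2 : F y = 0 := (mul_right_mem_nonZeroDivisors_eq_zero_iff (pow_mem ha _)).1 h1
  exact hinj (h2.trans (map_zero F).symm)

variable (Fq Q)

/-- The function field of `C_L = C ×_{Fq} L`, the ring of fractions of `Q ⊗ L`. -/
def CurveField : Type u := FractionRing (Q ⊗[Fq] L)

instance : CommRing (CurveField Fq Q L) := inferInstanceAs (CommRing (FractionRing (Q ⊗[Fq] L)))

instance : Algebra (Q ⊗[Fq] L) (CurveField Fq Q L) :=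
  inferInstanceAs (Algebra (Q ⊗[Fq] L) (FractionRing (Q ⊗[Fq] L)))

instance : IsFractionRing (Q ⊗[Fq] L) (CurveField Fq Q L) :=
  inferInstanceAs (IsFractionRing (Q ⊗[Fq] L) (FractionRing (Q ⊗[Fq] L)))

variable {Fq Q}

/-- For a subring `B` of `Q`, the natural map from `B ⊗ L` to the function field of `C_L`. -/
def toCurveField (B : Subalgebra Fq Q) : B ⊗[Fq] L →+* CurveField Fq Q L :=
  (algebraMap (Q ⊗[Fq] L) (CurveField Fq Q L)).comp
    (Algebra.TensorProduct.map B.val (AlgHom.id Fq L)).toRingHom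

variable (Fq Q) in
/-- The endomorphism `σ` of the function field of `C_L`. -/
def frobCurveField : CurveField Fq Q L →+* CurveField Fq Q L :=
  IsLocalization.map (M := nonZeroDivisors (Q ⊗[Fq] L)) (T := nonZeroDivisors (Q ⊗[Fq] L))
    (CurveField Fq Q L) (frob Fq L Q) (frob_nonZeroDivisors L)

theorem frobCurveField_toCurveField (B : Subalgebra Fq Q) (x : B ⊗[Fq] L) :
    frobCurveField Fq Q L (toCurveField L B x) = toCurveField L B (frob Fq L B x) := by
  have h : ∀ y : B ⊗[Fq] L, frob Fq L Q ((Algebra.TensorProduct.map B.val (AlgHom.id Fq L)) y) =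
      (Algebra.TensorProduct.map B.val (AlgHom.id Fq L)) (frob Fq L B y) := by
    intro y
    induction y using TensorProduct.induction_on with
    | zero => simp
    | tmul b x => simp [frob_tmul]
    | add x y hx hy => simp only [map_add, hx, hy]
  refine (IsLocalization.map_eq (M := nonZeroDivisors (Q ⊗[Fq] L))
    (T := nonZeroDivisors (Q ⊗[Fq] L)) (Q := CurveField Fq Q L) (frob_nonZeroDivisors L) _).trans ?_
  exact congrArg (algebraMap (Q ⊗[Fq] L) (CurveField Fq Q L)) (h x)

namespace RationalPoint

variable (P : RationalPoint Fq Q)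

/-- The ring `A_L = A ⊗ L`. -/
def coordRing : Type u := P.affineRing ⊗[Fq] L

instance : CommRing (P.coordRing L) := inferInstanceAs (CommRing (P.affineRing ⊗[Fq] L))

/-- `L` acts on `A_L = A ⊗ L` through the right factor. -/
instance : Algebra L (P.coordRing L) :=
  RingHom.toAlgebra (S := P.coordRing L)
    (Algebra.TensorProduct.includeRight : L →ₐ[Fq] P.affineRing ⊗[Fq] L).toRingHom

/-- The identification of `A_L` with `A ⊗ L`. -/
def coordRingEquiv : P.coordRing L ≃+* P.affineRing ⊗[Fq] L := RingEquiv.refl _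

/-- The endomorphism `σ` of `A_L`. -/
def sigma : P.coordRing L →+* P.coordRing L := frob Fq L P.affineRing

instance : Algebra (P.coordRing L) (CurveField Fq Q L) :=
  RingHom.toAlgebra (R := P.coordRing L) (toCurveField L P.affineRing)

/-- The ideal of `𝒪_{C,∞} ⊗ L` that is generated by the maximal ideal of `𝒪_{C,∞}`. Its residue
ring is `L`, so it is the maximal ideal of the point `∞` of `C_L`. -/
def inftyIdeal : Ideal (P.localRing ⊗[Fq] L) :=
  Ideal.span {x | ∃ z : P.localRing, P.valuationRing.valuation (z : Q) < 1 ∧ x = z ⊗ₜ[Fq] (1 : L)}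

theorem frob_mem_inftyIdeal (x : P.localRing ⊗[Fq] L) (hx : x ∈ P.inftyIdeal L) :
    frob Fq L P.localRing x ∈ P.inftyIdeal L := by
  have h : P.inftyIdeal L ≤ (P.inftyIdeal L).comap (frob Fq L P.localRing) := by
    refine Ideal.span_le.2 ?_
    rintro _ ⟨z, hz, rfl⟩
    refine Ideal.subset_span ⟨z, hz, ?_⟩
    rw [frob_tmul, one_pow]
  exact h hx

/-- The local ring of `C_L` at the point `∞`, inside the function field. Every element of
`𝒪_{C,∞} ⊗ L` that does not vanish at `∞` becomes congruent to `1` modulo `inftyIdeal` after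
multiplication by a constant of `L`, so these denominators suffice. -/
def stalk : Subring (CurveField Fq Q L) where
  carrier := {x | ∃ a b : P.localRing ⊗[Fq] L, b - 1 ∈ P.inftyIdeal L ∧
    x * toCurveField L P.localRing b = toCurveField L P.localRing a}
  one_mem' := ⟨1, 1, by simp, by simp⟩
  zero_mem' := ⟨0, 1, by simp, by simp⟩
  neg_mem' := by
    rintro x ⟨a, b, hb, h⟩
    exact ⟨-a, b, hb, by rw [neg_mul, h, map_neg]⟩
  mul_mem' := by
    rintro x y ⟨a, b, hb, h⟩ ⟨a', b', hb', h'⟩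
    refine ⟨a * a', b * b', ?_, ?_⟩
    · have : b * b' - 1 = (b - 1) * b' + (b' - 1) := by ring
      rw [this]
      exact add_mem (Ideal.mul_mem_right _ _ hb) hb'
    · rw [map_mul, map_mul, ← h, ← h']; ring
  add_mem' := by
    rintro x y ⟨a, b, hb, h⟩ ⟨a', b', hb', h'⟩
    refine ⟨a * b' + a' * b, b * b', ?_, ?_⟩
    · have : b * b' - 1 = (b - 1) * b' + (b' - 1) := by ring
      rw [this]
      exact add_mem (Ideal.mul_mem_right _ _ hb) hb'
    · rw [map_mul, map_add, map_mul, map_mul, ← h, ← h']; ring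

/-- The endomorphism `σ` of the local ring of `C_L` at `∞`. -/
def frobStalk : P.stalk L →+* P.stalk L :=
  (frobCurveField Fq Q L).restrict (P.stalk L) (P.stalk L) (by
    rintro x ⟨a, b, hb, h⟩
    refine ⟨frob Fq L _ a, frob Fq L _ b, ?_, ?_⟩
    · have := P.frob_mem_inftyIdeal L _ hb
      rwa [map_sub, map_one] at this
    · rw [← frobCurveField_toCurveField, ← frobCurveField_toCurveField, ← map_mul, h])

variable {L}

/-- For a submodule `N` over the local ring at `∞`, the module `N(k · ∞) = z^{-k} N`, where `z` is
a uniformizer at `∞`. -/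
def twist {V : Type u} [AddCommGroup V] [Module (CurveField Fq Q L) V]
    (N : Submodule (P.stalk L) V) (k : ℕ) : Submodule (P.stalk L) V where
  carrier := {v | ∀ z : Q, P.valuationRing.valuation z < 1 →
    algebraMap (Q ⊗[Fq] L) (CurveField Fq Q L) (z ⊗ₜ[Fq] (1 : L)) ^ k • v ∈ N}
  zero_mem' z _ := by rw [smul_zero]; exact N.zero_mem
  add_mem' hv hw z hz := by rw [smul_add]; exact N.add_mem (hv z hz) (hw z hz)
  smul_mem' s v hv z hz := by
    have h := N.smul_mem s (hv z hz)
    rwa [Subring.smul_def, smul_smul, mul_comm, ← smul_smul] at h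

end RationalPoint

end Curve

/-! ## Pure Anderson motives -/

section Motive

variable {Fq Q : Type u} [Field Fq] [Fintype Fq] [Field Q] [Algebra Fq Q]
  (P : RationalPoint Fq Q) {L : Type u} [Field L] [Algebra Fq L]

/-- The ideal `J` of `A_L` generated by the elements `a ⊗ 1 - 1 ⊗ c(a)`. -/
def charIdeal (c : P.affineRing →ₐ[Fq] L) : Ideal (P.coordRing L) :=
  Ideal.span (Set.range fun a : P.affineRing =>
    (P.coordRingEquiv L).symm (a ⊗ₜ[Fq] (1 : L) - 1 ⊗ₜ[Fq] c a))

variable {M : Type u} [AddCommGroup M] [Module (P.coordRing L) M]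

/-- The dimension over `L` of the cokernel of an `A_L`-linear map `σ^* M → M`. -/
def cokerDim (τ : Pullback (P.sigma L) M →ₗ[P.coordRing L] M) : Cardinal :=
  letI : Module L (M ⧸ LinearMap.range τ) :=
    Module.compHom _ (algebraMap L (P.coordRing L))
  Module.rank L (M ⧸ LinearMap.range τ)

/-- The map that `τ : σ^* M → M` induces on the generic fibre of `M`, written as the semilinear map
`f ⊗ m ↦ σ(f) ⊗ τ(1 ⊗ m)` over the function field of `C_L`. -/
def genericTau (τ : Pullback (P.sigma L) M →ₗ[P.coordRing L] M) :
    (CurveField Fq Q L ⊗[P.coordRing L] M) →ₛₗ[frobCurveField Fq Q L]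
      (CurveField Fq Q L ⊗[P.coordRing L] M) :=
  semilinearBaseChange (frobCurveField Fq Q L) (frobCurveField_toCurveField L P.affineRing)
    (τ.comp (Pullback.mk (P.sigma L)))

/-- The same map, considered as a semilinear map over the local ring of `C_L` at `∞`. -/
def stalkTau (τ : Pullback (P.sigma L) M →ₗ[P.coordRing L] M) :
    (CurveField Fq Q L ⊗[P.coordRing L] M) →ₛₗ[P.frobStalk L]
      (CurveField Fq Q L ⊗[P.coordRing L] M) where
  toFun := genericTau P τ
  map_add' := map_add _
  map_smul' s x := (genericTau P τ).map_smulₛₗ (s : CurveField Fq Q L) x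

/-- Purity. An extension of the locally free `A_L`-module `M` of rank `r` to a locally free sheaf
`ℳ` of rank `r` on `C_L` is the same as its stalk `N = ℳ_∞`, a free module of rank `r` over the
local ring at `∞` that spans the generic fibre of `M`. The motive is pure if for some such `N` and
some `k, l > 0` the map `τ^l` induces an isomorphism from `(σ^l)^* N` onto `N(k · ∞)`. -/
def IsPure (r : ℕ) (τ : Pullback (P.sigma L) M →ₗ[P.coordRing L] M) : Prop :=
  ∃ (b : Module.Basis (Fin r) (CurveField Fq Q L) (CurveField Fq Q L ⊗[P.coordRing L] M))
    (N : Submodule (P.stalk L) (CurveField Fq Q L ⊗[P.coordRing L] M)) (k l : ℕ),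
    N = Submodule.span (P.stalk L) (Set.range b) ∧ 0 < k ∧ 0 < l ∧
    Function.Injective (iterateOn (stalkTau P τ) N l) ∧
    LinearMap.range (iterateOn (stalkTau P τ) N l) = P.twist N k

/-- A pure Anderson motive over `L` of characteristic `c : A → L`. -/
structure PureAndersonMotive (c : P.affineRing →ₐ[Fq] L) where
  /-- the underlying `A_L`-module -/
  M : Type u
  [addCommGroup : AddCommGroup M]
  [module : Module (P.coordRing L) M]
  /-- the rank -/
  r : ℕ
  /-- the dimension -/
  d : ℕ
  finite : Module.Finite (P.coordRing L) M
  projective : Module.Projective (P.coordRing L) M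
  rank_eq : ∀ p : PrimeSpectrum (P.coordRing L), Module.rankAtStalk M p = r
  /-- the structure map `σ^* M → M` -/
  τ : Pullback (P.sigma L) M →ₗ[P.coordRing L] M
  injective : Function.Injective τ
  coker_dim : cokerDim P τ = d
  coker_ann : charIdeal P c ^ d ≤ Module.annihilator (P.coordRing L) (M ⧸ LinearMap.range τ)
  pure : IsPure P r τ

attribute [instance] PureAndersonMotive.addCommGroup PureAndersonMotive.module

variable {P} {c : P.affineRing →ₐ[Fq] L}

/-- A morphism of pure Anderson motives: an `A_L`-linear map `f` with `f ∘ τ = τ' ∘ σ^* f`. -/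
structure MotiveHom (X Y : PureAndersonMotive P c) where
  /-- the underlying `A_L`-linear map -/
  hom : X.M →ₗ[P.coordRing L] Y.M
  comm : hom ∘ₗ X.τ = Y.τ ∘ₗ Pullback.map (P.sigma L) hom

namespace MotiveHom

variable {X Y : PureAndersonMotive P c} (f : MotiveHom X Y)

/-- An isogeny is an injective morphism with torsion cokernel. -/
def IsIsogeny : Prop :=
  Function.Injective f.hom ∧ Module.IsTorsion (P.coordRing L) (Y.M ⧸ LinearMap.range f.hom)

/-- The map `σ^* coker f → coker f` induced by `τ`. -/
def cokerTau : Pullback (P.sigma L) (Y.M ⧸ LinearMap.range f.hom) →ₗ[P.coordRing L]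
    (Y.M ⧸ LinearMap.range f.hom) :=
  Pullback.lift (Submodule.mapQ (LinearMap.range f.hom) (LinearMap.range f.hom)
    (Y.τ.comp (Pullback.mk (P.sigma L))) (by
      rintro _ ⟨x, rfl⟩
      refine ⟨X.τ (Pullback.mk _ x), ?_⟩
      have h := LinearMap.congr_fun f.comm (Pullback.mk _ x)
      rw [LinearMap.comp_apply, LinearMap.comp_apply] at h
      refine h.trans ?_
      refine congrArg Y.τ ?_
      exact (Pullback.lift_tmul _ _ _).trans (one_smul _ _)))

/-- A separable isogeny is an isogeny for which `τ : σ^* coker f → coker f` is an isomorphism. -/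
def IsSeparableIsogeny : Prop :=
  f.IsIsogeny ∧ Function.Bijective f.cokerTau

end MotiveHom

/-- There is a separable isogeny from `X` to `Y`. -/
def SeparablyIsogenous (X Y : PureAndersonMotive P c) : Prop :=
  ∃ f : MotiveHom X Y, f.IsSeparableIsogeny

end Motive

end

/-! Part 1. Reflexivity and transitivity are formal; symmetry is the point. Let `f : X → Y` be a
separable isogeny over a finite field `L`. The cokernel of `f` is a finite set, because nonzero
principal ideals of `A` have finite index and `A_L` is a finite `A`-module. As `σ` is bijective,
separability says that the semilinear `τ` permutes this finite set. Hence some `m > 0` makes `τ^m`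
the identity on the cokernel and `σ^m` the identity on `A_L`. Then `1 - τ^m` is a linear
endomorphism of `Y` that commutes with `τ` and maps `Y` into the image of `f`, so it factors as `f ∘
g` for a morphism `g : Y → X`. Injectivity of `f` gives `g ∘ f = 1 - τ^m` on `X`, so `τ^m` is the
identity on the cokernel of `g`, and `τ` is bijective there: `g` is separable.

It remains to see that `1 - τ^m` is injective, and this is where purity enters
(`IsPureEndomorphism.eq_zero_of_iterate_eq`). With a uniformizer `z` at `∞` and the lattice `N` of
the purity condition, `z^k τ^l` maps `N` onto itself. Its `m`-th iterate `θ` is linear, and on a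
vector fixed by `τ^m` it acts as `z^(km)`. But `z` lies in the Jacobson radical of the local ring at
`∞`, so `θ - z^(km)` is surjective by Nakayama's lemma and hence injective on the finite module `N`.
Cokernels of injective endomorphisms being torsion, `g` is an isogeny.

Part 2. Consider `e₁ ↦ e₁ + t e₂`, `e₂ ↦ γ e₁` (`subMotive`) and `e₁ ↦ e₁ + e₂`, `e₂ ↦ γ t e₁`
(`superMotive`). The map `e₁ ↦ t e₁`, `e₂ ↦ e₂` embeds the first in the second; its cokernel is the
étale line `A_L/(t)` with a `τ`-fixed generator. In the other direction reduce modulo `t`. In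
`superMotive` the vector `e₂` is killed by `τ`, whereas in `subMotive` no nonzero vector is, because
`a^q + γ b^q = 0` forces `b = 0`: `γ` is not a `q`-th power in `L`. So every morphism back has its
image, modulo `t`, in the line of `e₁`. The image of `τ` on `subMotive` lies in this line too, so
`τ` cannot be surjective on the cokernel. -/

noncomputable section

/-! ### Finite index of principal ideals in rings of functions on a curve -/

section CurveFiniteness

open Polynomial

/-- In transcendence degree one, `x` alone is a transcendence basis, and a finitely generated
algebraic extension is finite. -/
theorem IsCurveFunctionField.finiteDimensional_adjoin {Fq Q : Type*} [Field Fq] [Field Q]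
    [Algebra Fq Q] (h : IsCurveFunctionField Fq Q) {x : Q} (hx : Transcendental Fq x) :
    FiniteDimensional (IntermediateField.adjoin Fq {x}) Q := by
  have hind : AlgebraicIndependent Fq (fun _ : Unit => x) :=
    algebraicIndependent_unique_type_iff.2 hx
  have hb : IsTranscendenceBasis Fq (fun _ : Unit => x) :=
    hind.isTranscendenceBasis_of_lift_trdeg_le_of_finite (by simp [h.trdeg_eq_one])
  have halg := hb.isAlgebraic_field
  rw [Set.range_const] at halg
  have : Algebra.EssFiniteType Fq Q := IntermediateField.fg_top_iff.1 h.fg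
  have : Algebra.EssFiniteType (IntermediateField.adjoin Fq {x}) Q :=
    Algebra.EssFiniteType.of_comp Fq _ _
  exact Algebra.finite_of_essFiniteType_of_isAlgebraic

/-- Elements of a subalgebra `B` whose classes modulo `x` are linearly independent over the field
of constants are linearly independent over the polynomials in `x`. -/
theorem aeval_eq_zero_of_linearIndependent_mk {k Q ι : Type*} [Field k] [Field Q] [Algebra k Q]
    (B : Subalgebra k Q) {x : B} (hx : x ≠ 0) (y : ι → B)
    (hy : LinearIndependent k (fun i => Ideal.Quotient.mk (Ideal.span {x}) (y i)))
    (n : ℕ) (s : Finset ι) (p : ι → k[X]) (hn : ∀ i ∈ s, (p i).natDegree ≤ n)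
    (h : ∑ i ∈ s, aeval x (p i) * y i = 0) : ∀ i ∈ s, p i = 0 := by
  have hsmul : ∀ (c : k) (b : B), c • Ideal.Quotient.mk (Ideal.span {x}) b =
      Ideal.Quotient.mk (Ideal.span {x}) (algebraMap k B c * b) := fun c b => by
    rw [← Algebra.smul_def]; rfl
  induction n generalizing p with
  | zero =>
    have hC : ∀ i ∈ s, p i = C ((p i).coeff 0) := fun i hi =>
      eq_C_of_natDegree_le_zero (hn i hi)
    have h0 : ∑ i ∈ s, (p i).coeff 0 • Ideal.Quotient.mk (Ideal.span {x}) (y i) = 0 := by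
      have := congrArg (Ideal.Quotient.mkₐ k (Ideal.span {x})) h
      rw [map_sum, map_zero] at this
      rw [← this]
      refine Finset.sum_congr rfl fun i hi => ?_
      rw [hC i hi, aeval_C, hsmul, coeff_C_zero]
      rfl
    intro i hi
    rw [hC i hi, linearIndependent_iff'.1 hy s _ h0 i hi, C_0]
  | succ n ih =>
    have hdiv : ∀ i, p i = X * (p i).divX + C ((p i).coeff 0) := fun i =>
      (X_mul_divX_add (p i)).symm
    have hev : ∀ i, aeval x (p i) =
        x * aeval x (p i).divX + algebraMap k B ((p i).coeff 0) := by
      intro i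
      conv_lhs => rw [hdiv i]
      rw [map_add, map_mul, aeval_X, aeval_C]
    -- Modulo `x` only the constant coefficients survive, and they vanish by independence; then `x`
    -- can be cancelled and the degrees drop.
    have h0 : ∑ i ∈ s, (p i).coeff 0 • Ideal.Quotient.mk (Ideal.span {x}) (y i) = 0 := by
      have := congrArg (Ideal.Quotient.mkₐ k (Ideal.span {x})) h
      rw [map_sum, map_zero] at this
      rw [← this]
      refine Finset.sum_congr rfl fun i hi => ?_
      have hx0 : Ideal.Quotient.mkₐ k (Ideal.span {x}) x = 0 :=
        Ideal.Quotient.eq_zero_iff_mem.2 (Ideal.mem_span_singleton_self x)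
      rw [hev, map_mul, map_add, map_mul, hx0, zero_mul, zero_add, hsmul, map_mul]
      rfl
    have hc := linearIndependent_iff'.1 hy s _ h0
    have h1 : ∑ i ∈ s, aeval x (p i).divX * y i = 0 := by
      have : x * ∑ i ∈ s, aeval x (p i).divX * y i = 0 := by
        rw [← h, Finset.mul_sum]
        refine Finset.sum_congr rfl fun i hi => ?_
        rw [hev, hc i hi, map_zero, add_zero, mul_assoc]
      exact (mul_eq_zero.1 this).resolve_left hx
    have h2 := ih (fun i => (p i).divX) (fun i hi => by
      rw [natDegree_divX_eq_natDegree_tsub_one]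
      have := hn i hi
      omega) h1
    intro i hi
    rw [hdiv i, h2 i hi, hc i hi]
    simp

open scoped IntermediateField.algebraAdjoinAdjoin in
/-- A nonzero principal ideal of a subalgebra of the function field of a curve over a finite field
has finite index. -/
theorem IsCurveFunctionField.finite_quotient_span {Fq Q : Type*} [Field Fq] [Finite Fq] [Field Q]
    [Algebra Fq Q] (h : IsCurveFunctionField Fq Q) (B : Subalgebra Fq Q) {x : B} (hx : x ≠ 0) :
    Finite (B ⧸ Ideal.span {x}) := by
  -- For algebraic `x` the ring `Fq[x]` is a field, so `x` is a unit of `B` and the quotient is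
  -- trivial.
  by_cases hxa : IsAlgebraic Fq x
  · have hu : IsUnit x := by
      have : Algebra.IsIntegral Fq (Algebra.adjoin Fq {x}) :=
        Algebra.IsIntegral.adjoin (by simpa using hxa.isIntegral)
      have hB : IsField (Algebra.adjoin Fq {x}) :=
        isField_of_isIntegral_of_isField' (Field.toIsField Fq)
      obtain ⟨y, hy⟩ := hB.mul_inv_cancel
        (a := ⟨x, Algebra.self_mem_adjoin_singleton Fq x⟩) (fun h => hx (congrArg Subtype.val h))
      exact IsUnit.of_mul_eq_one y (congrArg Subtype.val hy)
    rw [Ideal.span_singleton_eq_top.2 hu]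
    infer_instance
  have hxt : Transcendental Fq (x : Q) := fun h' => hxa
    ((isAlgebraic_algHom_iff B.val Subtype.val_injective).1 h')
  have := h.finiteDimensional_adjoin hxt
  have : Module.Free Fq (B ⧸ Ideal.span {x}) := Module.Free.of_divisionRing _ _
  let b := Module.Free.chooseBasis Fq (B ⧸ Ideal.span {x})
  choose y hy using fun i => Ideal.Quotient.mk_surjective (b i)
  have hy' : LinearIndependent Fq (fun i => Ideal.Quotient.mk (Ideal.span {x}) (y i)) := by
    simpa only [hy] using b.linearIndependent
  -- The lifted basis is independent over `Fq[x]`, hence over `Fq(x)`, so it has at most `[Q :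
  -- Fq(x)]` elements.
  have hli : LinearIndependent (Algebra.adjoin Fq {(x : Q)}) (fun i => (y i : Q)) := by
    rw [linearIndependent_iff']
    intro s g hg
    choose p hp using fun i => (Algebra.adjoin_singleton_eq_range_aeval Fq (x : Q)).le (g i).2
    have hps := aeval_eq_zero_of_linearIndependent_mk B hx y hy'
      (s.sup fun i => (p i).natDegree) s p
      (fun i hi => Finset.le_sup (f := fun i => (p i).natDegree) hi) (by
        apply Subtype.val_injective
        have : ∀ i, ((aeval x (p i) : B) : Q) = g i := fun i => by
          rw [← hp i]; exact (aeval_algHom_apply B.val x (p i)).symm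
        simpa [this, Subalgebra.smul_def] using hg)
    intro i hi
    apply Subtype.val_injective
    rw [← hp i, hps i hi]
    simp
  have hli' := (LinearIndependent.iff_fractionRing (Algebra.adjoin Fq {(x : Q)})
    (IntermediateField.adjoin Fq {(x : Q)})).1 hli
  have := hli'.finite
  have : Module.Finite Fq (B ⧸ Ideal.span {x}) := Module.Finite.of_basis b
  exact Module.finite_of_finite Fq

end CurveFiniteness

/-! ### Existence of a uniformizer at a rational point -/

section Uniformizer

variable {Fq Q : Type u} [Field Fq] [Fintype Fq] [Field Q] [Algebra Fq Q]

/-- The local ring at a rational point has a uniformizer. -/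
theorem RationalPoint.exists_uniformizer (h : IsCurveFunctionField Fq Q) (P : RationalPoint Fq Q) :
    ∃ z : Q, z ≠ 0 ∧ P.valuationRing.valuation z < 1 ∧
      ∀ w, P.valuationRing.valuation w < 1 →
        P.valuationRing.valuation w ≤ P.valuationRing.valuation z := by
  set v := P.valuationRing.valuation with hv
  have hmem : ∀ {w : Q}, w ∈ P.localRing ↔ v w ≤ 1 := fun {w} =>
    (P.valuationRing.valuation_le_one_iff w).symm
  let S : Set P.localRing := {w | w ≠ 0 ∧ v w < 1}
  have hS : S.Nonempty := by
    obtain ⟨q, hq⟩ : ∃ q : Q, q ∉ P.valuationRing := by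
      by_contra! hcon
      exact P.isPlace.1 (eq_top_iff.2 fun x _ => hcon x)
    have hq1 : 1 < v q := not_le.1 fun hle => hq ((P.valuationRing.valuation_le_one_iff q).1 hle)
    have hq0 : q ≠ 0 := by rintro rfl; exact hq P.valuationRing.zero_mem
    have hlt : v q⁻¹ < 1 := by rw [map_inv₀]; exact inv_lt_one_of_one_lt₀ hq1
    exact ⟨⟨q⁻¹, hmem.2 hlt.le⟩, fun h0 => inv_ne_zero hq0 (congrArg Subtype.val h0), hlt⟩
  -- Among the nonzero elements of the maximal ideal, `z` generates an ideal of least index. An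
  -- element `w` of larger valuation would generate an ideal that contains `(z)`; by minimality the
  -- two agree, a contradiction.
  obtain ⟨z, ⟨hz0, hz1⟩, hmin⟩ := exists_minimalFor_of_wellFoundedLT (· ∈ S)
    (fun w => Nat.card (P.localRing ⧸ Ideal.span {w})) hS
  refine ⟨z, fun h0 => hz0 (Subtype.val_injective h0), hz1, fun w hw => ?_⟩
  by_contra! hlt
  have hw0 : w ≠ 0 := by rintro rfl; simp at hlt
  let w' : P.localRing := ⟨w, hmem.2 hw.le⟩
  have hle : Ideal.span {z} ≤ Ideal.span {w'} := by
    rw [Ideal.span_singleton_le_span_singleton]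
    refine ⟨⟨z / w, hmem.2 ?_⟩, Subtype.val_injective ?_⟩
    · rw [map_div₀]; exact div_le_one_of_le₀ hlt.le zero_le
    · exact (mul_div_cancel₀ _ hw0).symm
  have := h.finite_quotient_span P.localRing hz0
  have hcard := hmin (j := w') ⟨fun h0 => hw0 (congrArg Subtype.val h0), hw⟩
    (Nat.card_le_card_of_surjective _ (Ideal.Quotient.factor_surjective hle))
  have hbij := (Ideal.Quotient.factor_surjective hle).bijective_of_nat_card_le hcard
  have hw'z : w' ∈ Ideal.span {z} := by
    rw [← Ideal.Quotient.eq_zero_iff_mem]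
    apply hbij.1
    rw [map_zero, Ideal.Quotient.factor_mk, Ideal.Quotient.eq_zero_iff_mem]
    exact Ideal.mem_span_singleton_self w'
  obtain ⟨c, hc⟩ := Ideal.mem_span_singleton.1 hw'z
  have hc' : w = z * c := congrArg Subtype.val hc
  rw [hc', map_mul] at hlt
  exact absurd hlt (not_lt.2 (mul_le_of_le_one_right' (hmem.1 c.2)))

end Uniformizer

/-! ### Semilinear maps and their linearizations -/

section PullbackLemmas

variable {R : Type*} [CommRing R] {σ : R →+* R} {M N : Type*} [AddCommGroup M] [Module R M]
  [AddCommGroup N] [Module R N]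

theorem Pullback.tmul_eq_smul_mk (a : R) (m : M) :
    Pullback.tmul σ a m = a • Pullback.mk σ m := by
  change _ = a • Pullback.tmul σ 1 m
  rw [Pullback.smul_tmul, mul_one]

theorem Pullback.lift_mk (φ : M →ₛₗ[σ] N) (m : M) : Pullback.lift φ (Pullback.mk σ m) = φ m :=
  (Pullback.lift_tmul φ 1 m).trans (one_smul _ _)

theorem Pullback.map_mk (f : M →ₗ[R] N) (m : M) :
    Pullback.map σ f (Pullback.mk σ m) = Pullback.mk σ (f m) :=
  Pullback.lift_mk _ m

theorem Pullback.mk_smul (r : R) (m : M) :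
    Pullback.mk σ (r • m) = σ r • Pullback.mk σ m :=
  (Pullback.mk σ).map_smulₛₗ r m

theorem Pullback.hom_ext {f g : Pullback σ M →ₗ[R] N}
    (h : ∀ m, f (Pullback.mk σ m) = g (Pullback.mk σ m)) : f = g := by
  refine LinearMap.ext fun x => ?_
  induction x using Pullback.induction with
  | h0 => rw [map_zero, map_zero]
  | ht a m => rw [Pullback.tmul_eq_smul_mk, map_smul, map_smul, h]
  | ha x y hx hy => rw [map_add, map_add, hx, hy]

/-- A coefficient of the form `σ b` can be moved across the tensor sign into the module. -/
theorem Pullback.mk_surjective (hσ : Function.Surjective σ) :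
    Function.Surjective (Pullback.mk σ : M → Pullback σ M) := by
  intro x
  induction x using Pullback.induction with
  | h0 => exact ⟨0, map_zero _⟩
  | ht a m =>
    obtain ⟨b, rfl⟩ := hσ a
    exact ⟨b • m, by rw [Pullback.mk_smul, Pullback.tmul_eq_smul_mk]⟩
  | ha x y hx hy =>
    obtain ⟨m, rfl⟩ := hx
    obtain ⟨n, rfl⟩ := hy
    exact ⟨m + n, map_add _ _ _⟩

theorem Pullback.mk_injective (hσ : Function.Bijective σ) :
    Function.Injective (Pullback.mk σ : M → Pullback σ M) := by
  let e : R ≃+* R := RingEquiv.ofBijective σ hσ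
  have he : ∀ r, e.symm (σ r) = r := fun r => e.symm_apply_apply r
  -- The left inverse is `a ⊗ m ↦ σ⁻¹(a) m`.
  let F : Pullback σ M →+ M := TensorProduct.liftAddHom (R := R) (M := Twisted σ) (N := M)
    { toFun := fun a : R =>
        { toFun := fun m => e.symm a • m
          map_zero' := smul_zero _
          map_add' := smul_add _ }
      map_zero' := by
        ext m
        change e.symm (0 : R) • m = 0
        rw [map_zero, zero_smul]
      map_add' := fun a b => by
        ext m
        change e.symm ((show R from a) + (show R from b)) • m = e.symm a • m + e.symm b • m
        rw [map_add, add_smul] }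
    (by
      intro r a m
      change e.symm (σ r * (show R from a)) • m = e.symm a • r • m
      rw [map_mul, he, mul_comm, smul_smul])
  have hF : ∀ m, F (Pullback.mk σ m) = m := fun m => by
    change e.symm 1 • m = m
    rw [map_one, one_smul]
  exact Function.LeftInverse.injective hF

/-- For an automorphism `σ`, a semilinear map is bijective if and only if its linearization is. -/
theorem Pullback.lift_bijective_iff (hσ : Function.Bijective σ) (φ : M →ₛₗ[σ] N) :
    Function.Bijective (Pullback.lift φ) ↔ Function.Bijective φ := by
  have h : (Pullback.lift φ ∘ Pullback.mk σ : M → N) = φ := funext (Pullback.lift_mk φ)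
  rw [← h]
  exact ((Function.Bijective.of_comp_iff _
    ⟨Pullback.mk_injective hσ, Pullback.mk_surjective hσ.2⟩)).symm

theorem iterateOn_mk (φ : M →ₛₗ[σ] M) (N : Submodule R M) (l : ℕ) (n : N) :
    iterateOn φ N l (Pullback.mk _ n) = φ^[l] n :=
  Pullback.lift_mk _ n

/-- The `m`-th iterate of a semilinear endomorphism is linear if `σ ^ m` is the identity. -/
def linearIterate (φ : M →ₛₗ[σ] M) (m : ℕ) (hm : ∀ r, σ^[m] r = r) : M →ₗ[R] M where
  toFun := φ^[m]
  map_add' := (semilinearIterate φ m).map_add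
  map_smul' r x := by
    have h := (semilinearIterate φ m).map_smulₛₗ r x
    rw [RingHom.coe_pow, hm] at h
    exact h

end PullbackLemmas

/-! ### Injective endomorphisms, torsion modules and Nakayama's lemma -/

section CommutativeAlgebra

open Polynomial nonZeroDivisors

/-- The cokernel of an injective endomorphism of a finite module over a domain is annihilated by a
nonzero element. -/
theorem exists_smul_mem_range_of_injective {R W : Type*} [CommRing R] [IsDomain R]
    [AddCommGroup W] [Module R W] [Module.Finite R W] (φ : W →ₗ[R] W)
    (hφ : Function.Injective φ) : ∃ r : R, r ≠ 0 ∧ ∀ w, r • w ∈ LinearMap.range φ := by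
  obtain ⟨p, hp, hp0⟩ := LinearMap.exists_monic_and_aeval_eq_zero R φ
  -- By injectivity of `φ`, factors `X` can be stripped off an annihilating polynomial until its
  -- constant coefficient is nonzero. The relation `p(φ) = 0` then shows that this coefficient maps
  -- `W` into the range of `φ`.
  have key : ∀ (n : ℕ) (p : R[X]), p ≠ 0 → p.natDegree ≤ n → aeval φ p = 0 →
      ∃ r : R, r ≠ 0 ∧ ∀ w, r • w ∈ LinearMap.range φ := by
    intro n
    induction n with
    | zero =>
      intro p hp hn h0
      rw [eq_C_of_natDegree_le_zero hn, aeval_C] at h0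
      refine ⟨p.coeff 0, fun hc => hp ?_, fun w => ?_⟩
      · rw [eq_C_of_natDegree_le_zero hn, hc, C_0]
      · have := LinearMap.congr_fun h0 w
        rw [Module.algebraMap_end_apply] at this
        rw [this]
        exact zero_mem _
    | succ n ih =>
      intro p hp hn h0
      have hdecomp := X_mul_divX_add p
      have hev : ∀ w, φ (aeval φ p.divX w) + p.coeff 0 • w = 0 := fun w => by
        have := LinearMap.congr_fun h0 w
        rw [← hdecomp, map_add, map_mul, aeval_X, aeval_C] at this
        exact this
      by_cases hc : p.coeff 0 = 0
      · refine ih p.divX (fun hd => hp ?_) ?_ (LinearMap.ext fun w => hφ ?_)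
        · rw [← hdecomp, hd, hc]; simp
        · rw [natDegree_divX_eq_natDegree_tsub_one]; omega
        · have := hev w
          rw [hc, zero_smul, add_zero] at this
          rw [this]; simp
      · refine ⟨p.coeff 0, hc, fun w => ⟨-aeval φ p.divX w, ?_⟩⟩
        rw [map_neg]
        exact neg_eq_of_add_eq_zero_right (hev w)
  exact key _ p hp.ne_zero le_rfl hp0

theorem algebraMap_mem_nonZeroDivisors_of_flat {R S : Type*} [CommRing R] [IsDomain R]
    [CommRing S] [Algebra R S] [Module.Flat R S] {r : R} (hr : r ≠ 0) : algebraMap R S r ∈ S⁰ := by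
  rw [mem_nonZeroDivisors_iff_right]
  intro x hx
  refine Module.Flat.isSMulRegular_of_isRegular (M := S) (IsRegular.of_ne_zero hr) ?_
  change r • x = r • 0
  rw [smul_zero, Algebra.smul_def, mul_comm, hx]

/-- The cokernel of an injective endomorphism of a finite module is torsion. -/
theorem exists_nonZeroDivisor_smul_mem_range (R : Type*) {S : Type*} [CommRing R] [IsDomain R]
    [CommRing S] [Algebra R S] [Module.Finite R S] [Module.Flat R S] {W : Type*} [AddCommGroup W]
    [Module S W] [Module.Finite S W] (φ : W →ₗ[S] W)
    (hφ : Function.Injective φ) : ∃ s ∈ S⁰, ∀ w, s • w ∈ LinearMap.range φ := by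
  let : Module R W := Module.compHom W (algebraMap R S)
  have : IsScalarTower R S W := IsScalarTower.of_algebraMap_smul fun _ _ => rfl
  have : Module.Finite R W := Module.Finite.trans S W
  obtain ⟨r, hr, h⟩ := exists_smul_mem_range_of_injective (φ.restrictScalars R) hφ
  refine ⟨algebraMap R S r, algebraMap_mem_nonZeroDivisors_of_flat hr, fun w => ?_⟩
  rw [algebraMap_smul]
  exact h w

/-- A finite torsion module is finite as a set if the base ring has finite proper quotients. -/
theorem finite_of_isTorsion (R : Type*) {S : Type*} [CommRing R] [IsDomain R]
    [CommRing S] [Algebra R S] [Module.Finite R S] [Module.Flat R S] {W : Type*} [AddCommGroup W]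
    [Module S W] [Module.Finite S W]
    (hR : ∀ r : R, r ≠ 0 → Finite (R ⧸ Ideal.span {r})) (hW : Module.IsTorsion S W) :
    Finite W := by
  obtain ⟨s, hs, hs0⟩ := Submodule.annihilator_top_inter_nonZeroDivisors hW
  -- A single non-zero-divisor `s` kills `W`. Applied to multiplication by `s`, the previous lemma
  -- gives a nonzero `r` in `R` divisible by `s` in `S`, so `W` is a finite module over the finite
  -- ring `R/(r)`.
  obtain ⟨r, hr, h⟩ := exists_smul_mem_range_of_injective (LinearMap.mulLeft R s)
    (fun x y hxy => (mul_cancel_left_mem_nonZeroDivisors hs0).1 hxy)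
  obtain ⟨t, ht⟩ := h 1
  let : Module R W := Module.compHom W (algebraMap R S)
  have : IsScalarTower R S W := IsScalarTower.of_algebraMap_smul fun _ _ => rfl
  have : Module.Finite R W := Module.Finite.trans S W
  have htor : Module.IsTorsionBySet R W (Ideal.span {r} : Ideal R) := by
    rw [Module.isTorsionBySet_span_singleton_iff]
    intro w
    rw [← algebraMap_smul S, Algebra.algebraMap_eq_smul_one, ← ht, LinearMap.mulLeft_apply,
      mul_comm, mul_smul, Submodule.mem_annihilator.1 hs w Submodule.mem_top, smul_zero]
  let := htor.module
  have : IsScalarTower R (R ⧸ Ideal.span {r}) W := htor.isScalarTower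
  have : Module.Finite (R ⧸ Ideal.span {r}) W := Module.Finite.of_restrictScalars_finite R _ _
  have := hR r hr
  exact Module.finite_of_finite (R ⧸ Ideal.span {r})

/-- Nakayama's lemma: subtracting a scalar in the Jacobson radical from a surjective endomorphism of
a finite module leaves an injective endomorphism. -/
theorem injective_sub_smul_of_surjective {R N : Type*} [CommRing R] [AddCommGroup N] [Module R N]
    [Module.Finite R N] (θ : N →ₗ[R] N) (hθ : Function.Surjective θ) {j : R}
    (hj : j ∈ Ideal.jacobson (⊥ : Ideal R)) :
    Function.Injective (θ - j • (LinearMap.id : N →ₗ[R] N)) := by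
  -- From `θ x = (θ - j) x + j x` it follows that `N = im (θ - j) + j N`, whence `θ - j` is
  -- surjective.
  refine OrzechProperty.injective_of_surjective_endomorphism _ (LinearMap.range_eq_top.1 ?_)
  refine top_le_iff.1 (Submodule.le_of_le_smul_of_le_jacobson_bot (I := Ideal.span {j})
    Module.Finite.fg_top ((Ideal.span_singleton_le_iff_mem _).2 hj) fun y _ => ?_)
  obtain ⟨x, rfl⟩ := hθ y
  have h : θ x = (θ - j • (LinearMap.id : N →ₗ[R] N)) x + j • x := by simp
  rw [h]
  exact Submodule.add_mem_sup ⟨x, rfl⟩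
    (Submodule.smul_mem_smul (Ideal.mem_span_singleton_self j) Submodule.mem_top)

end CommutativeAlgebra

/-! ### Over a finite field some power of `σ` is the identity -/

section FrobeniusIterates

variable {Fq Q : Type u} [Field Fq] [Fintype Fq] [Field Q] [Algebra Fq Q]
  {L : Type u} [Field L] [Algebra Fq L]

variable (Fq L) in
theorem exists_pow_card_pow_eq [Finite L] :
    ∃ e : ℕ, 0 < e ∧ ∀ x : L, x ^ Fintype.card Fq ^ e = x := by
  have := Fintype.ofFinite L
  refine ⟨Module.finrank Fq L, Module.finrank_pos, fun x => ?_⟩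
  rw [← Module.card_eq_pow_finrank (K := Fq) (V := L), FiniteField.pow_card]

theorem frob_iterate_tmul {B : Type u} [CommRing B] [Algebra Fq B] (n : ℕ) (b : B) (x : L) :
    (frob Fq L B)^[n] (b ⊗ₜ x) = b ⊗ₜ (x ^ Fintype.card Fq ^ n) := by
  induction n with
  | zero => simp
  | succ n ih => rw [Function.iterate_succ_apply', ih, frob_tmul, ← pow_mul, pow_succ]

theorem frob_iterate_eq {m : ℕ} (hm : ∀ x : L, x ^ Fintype.card Fq ^ m = x) (B : Type u)
    [CommRing B] [Algebra Fq B] (x : B ⊗[Fq] L) : (frob Fq L B)^[m] x = x := by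
  induction x using TensorProduct.induction_on with
  | zero => exact iterate_map_zero _ _
  | tmul b x => rw [frob_iterate_tmul, hm]
  | add x y hx hy => rw [iterate_map_add, hx, hy]

theorem frobCurveField_algebraMap (x : Q ⊗[Fq] L) :
    frobCurveField Fq Q L (algebraMap _ _ x) = algebraMap _ (CurveField Fq Q L) (frob Fq L Q x) :=
  IsLocalization.map_eq (M := nonZeroDivisors (Q ⊗[Fq] L))
    (T := nonZeroDivisors (Q ⊗[Fq] L)) (Q := CurveField Fq Q L) (frob_nonZeroDivisors L) _

theorem frobCurveField_iterate_eq {m : ℕ} (hm : ∀ x : L, x ^ Fintype.card Fq ^ m = x)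
    (x : CurveField Fq Q L) : (frobCurveField Fq Q L)^[m] x = x := by
  have h : ∀ n (y : Q ⊗[Fq] L), (frobCurveField Fq Q L)^[n] (algebraMap _ _ y) =
      algebraMap _ (CurveField Fq Q L) ((frob Fq L Q)^[n] y) := by
    intro n y
    induction n with
    | zero => rfl
    | succ n ih => rw [Function.iterate_succ_apply', ih, frobCurveField_algebraMap,
        Function.iterate_succ_apply']
  have h2 : (frobCurveField Fq Q L) ^ m = RingHom.id _ := by
    refine IsLocalization.ringHom_ext (nonZeroDivisors (Q ⊗[Fq] L)) (RingHom.ext fun y => ?_)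
    rw [RingHom.comp_apply, RingHom.coe_pow, h, frob_iterate_eq hm]
    rfl
  rw [← RingHom.coe_pow, h2]
  rfl

theorem RationalPoint.coe_frobStalk_iterate (P : RationalPoint Fq Q) (n : ℕ) (x : P.stalk L) :
    (((P.frobStalk L)^[n] x : P.stalk L) : CurveField Fq Q L) = (frobCurveField Fq Q L)^[n] x := by
  induction n with
  | zero => rfl
  | succ n ih =>
    rw [Function.iterate_succ_apply', Function.iterate_succ_apply', ← ih]
    rfl

theorem RationalPoint.frobStalk_iterate_eq (P : RationalPoint Fq Q) {m : ℕ}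
    (hm : ∀ x : L, x ^ Fintype.card Fq ^ m = x) (x : P.stalk L) : (P.frobStalk L)^[m] x = x :=
  Subtype.val_injective ((P.coe_frobStalk_iterate m x).trans (frobCurveField_iterate_eq hm _))

theorem bijective_of_iterate_eq {α : Type*} {f : α → α} {m : ℕ} (hm : 0 < m)
    (h : ∀ x, f^[m] x = x) : Function.Bijective f := by
  obtain ⟨n, rfl⟩ := Nat.exists_eq_succ_of_ne_zero hm.ne'
  exact ⟨fun x y hxy => (h x).symm.trans ((congrArg f^[n] hxy).trans (h y)), fun x =>
    ⟨f^[n] x, (Function.iterate_succ_apply' f n x).symm.trans (h x)⟩⟩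

theorem iterate_mul_eq {α : Type*} {f : α → α} {m : ℕ} {x : α} (h : f^[m] x = x) (l : ℕ) :
    f^[m * l] x = x := by
  rw [Function.iterate_mul]
  exact Function.iterate_fixed h l

end FrobeniusIterates

/-! ### The local ring of `C_L` at `∞` -/

section Stalk

variable {Fq Q : Type u} [Field Fq] [Fintype Fq] [Field Q] [Algebra Fq Q]
  {L : Type u} [Field L] [Algebra Fq L]

variable (Fq L) in
/-- The inclusion of the function field of `C` in that of `C_L`. -/
def ofFunction : Q →+* CurveField Fq Q L :=
  (algebraMap (Q ⊗[Fq] L) (CurveField Fq Q L)).comp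
    (Algebra.TensorProduct.includeLeft : Q →ₐ[Fq] Q ⊗[Fq] L).toRingHom

theorem frobCurveField_ofFunction (z : Q) :
    frobCurveField Fq Q L (ofFunction Fq L z) = ofFunction Fq L z := by
  refine (frobCurveField_algebraMap _).trans ?_
  change algebraMap _ _ (frob Fq L Q (z ⊗ₜ 1)) = _
  rw [frob_tmul, one_pow]
  rfl

theorem isUnit_ofFunction {z : Q} (hz : z ≠ 0) : IsUnit (ofFunction Fq L z) :=
  (isUnit_iff_ne_zero.2 hz).map _

theorem RationalPoint.toCurveField_mem_stalk (P : RationalPoint Fq Q)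
    (a : P.localRing ⊗[Fq] L) : toCurveField L P.localRing a ∈ P.stalk L :=
  ⟨a, 1, by simp, by simp⟩

theorem RationalPoint.ofFunction_mem_stalk (P : RationalPoint Fq Q) {z : Q}
    (hz : z ∈ P.valuationRing) : ofFunction Fq L z ∈ P.stalk L :=
  P.toCurveField_mem_stalk ((⟨z, hz⟩ : P.localRing) ⊗ₜ 1)

/-- The value of `ℳ(k · ∞)` at `∞` in terms of a uniformizer. -/
theorem RationalPoint.mem_twist_iff (P : RationalPoint Fq Q) {z : Q} (hz0 : z ≠ 0)
    (hz1 : P.valuationRing.valuation z < 1)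
    (hz : ∀ w, P.valuationRing.valuation w < 1 →
      P.valuationRing.valuation w ≤ P.valuationRing.valuation z)
    {V : Type u} [AddCommGroup V] [Module (CurveField Fq Q L) V] (N : Submodule (P.stalk L) V)
    (k : ℕ) (v : V) : v ∈ P.twist N k ↔ ofFunction Fq L z ^ k • v ∈ N := by
  refine ⟨fun h => h z hz1, fun h w hw => ?_⟩
  have hc : w / z ∈ P.valuationRing := by
    rw [← P.valuationRing.valuation_le_one_iff, map_div₀]
    exact div_le_one_of_le₀ (hz w hw) zero_le
  have h2 := N.smul_mem (⟨_, P.ofFunction_mem_stalk (L := L) hc⟩ ^ k : P.stalk L) h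
  have h3 : ofFunction Fq L w = ofFunction Fq L (w / z) * ofFunction Fq L z := by
    rw [← map_mul, div_mul_cancel₀ _ hz0]
  change ofFunction Fq L w ^ k • v ∈ N
  rw [h3, mul_pow, mul_smul]
  exact h2

/-- For finite `L` the ring `𝒪_{C,∞} ⊗ L` is integral over the local ring `𝒪_{C,∞}`, so each of its
maximal ideals lies over the maximal ideal of the latter and contains the generators of
`inftyIdeal`. -/
theorem RationalPoint.inftyIdeal_le_jacobson [Finite L] (P : RationalPoint Fq Q) :
    P.inftyIdeal L ≤ Ideal.jacobson ⊥ := by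
  refine Ideal.span_le.2 ?_
  rintro _ ⟨z, hz, rfl⟩
  refine Ideal.mem_sInf.2 fun {J} hJ => ?_
  have hJmax : J.IsMaximal := hJ.2
  have : Module.Finite Fq L := Module.Finite.of_finite
  have hmax := Ideal.isMaximal_comap_of_isIntegral_of_isMaximal (R := P.localRing) J
  let e : P.valuationRing ≃+* P.localRing :=
    { toFun := fun x => ⟨x.1, x.2⟩
      invFun := fun x => ⟨x.1, x.2⟩
      left_inv := fun _ => rfl
      right_inv := fun _ => rfl
      map_mul' := fun _ _ => rfl
      map_add' := fun _ _ => rfl }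
  have : IsLocalRing P.localRing := e.isLocalRing
  have hzmem : z ∈ IsLocalRing.maximalIdeal P.localRing := by
    rw [IsLocalRing.mem_maximalIdeal]
    intro hu
    obtain ⟨y, hy⟩ := hu.exists_right_inv
    have h1 := congrArg P.valuationRing.valuation (congrArg Subtype.val hy)
    have h2 : P.valuationRing.valuation (y : Q) ≤ 1 :=
      (P.valuationRing.valuation_le_one_iff _).2 y.2
    have h3 : P.valuationRing.valuation (z : Q) * P.valuationRing.valuation (y : Q) = 1 := by
      rw [← map_mul, ← map_one P.valuationRing.valuation]
      exact h1
    exact absurd h3 (mul_lt_one_of_lt_of_le hz h2).ne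
  rw [← IsLocalRing.eq_maximalIdeal hmax] at hzmem
  exact hzmem

theorem RationalPoint.isUnit_of_sub_one_mem [Finite L] (P : RationalPoint Fq Q)
    {b : P.localRing ⊗[Fq] L} (hb : b - 1 ∈ P.inftyIdeal L) : IsUnit b := by
  have h := Ideal.mem_jacobson_bot.1 (P.inftyIdeal_le_jacobson hb) 1
  rwa [mul_one, sub_add_cancel] at h

/-- A function that vanishes at `∞` lies in the Jacobson radical of the local ring of `C_L`. -/
theorem RationalPoint.ofFunction_mem_jacobson [Finite L] (P : RationalPoint Fq Q) {z : Q}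
    (hz : z ∈ P.valuationRing) (hz1 : P.valuationRing.valuation z < 1) :
    (⟨ofFunction Fq L z, P.ofFunction_mem_stalk hz⟩ : P.stalk L) ∈
      Ideal.jacobson (⊥ : Ideal (P.stalk L)) := by
  rw [Ideal.mem_jacobson_bot]
  rintro ⟨y, a, b, hb, hy⟩
  let z' : P.localRing ⊗[Fq] L := (⟨z, hz⟩ : P.localRing) ⊗ₜ 1
  have hz' : toCurveField L P.localRing z' = ofFunction Fq L z := rfl
  have hzI : z' ∈ P.inftyIdeal L := Ideal.subset_span ⟨⟨z, hz⟩, hz1, rfl⟩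
  -- For `y = a / b` one has `(z y + 1) b = b + z a`, which is again congruent to `1` at `∞`.
  have hu : IsUnit (b + z' * a) := P.isUnit_of_sub_one_mem (by
    have : b + z' * a - 1 = (b - 1) + z' * a := by ring
    rw [this]
    exact add_mem hb (Ideal.mul_mem_right _ _ hzI))
  obtain ⟨w, hw⟩ := hu.exists_right_inv
  refine IsUnit.of_mul_eq_one ⟨_, P.toCurveField_mem_stalk (b * w)⟩ (Subtype.val_injective ?_)
  change (ofFunction Fq L z * y + 1) * toCurveField L P.localRing (b * w) = 1
  have h1 : toCurveField L P.localRing ((b + z' * a) * w) = 1 := by rw [hw, map_one]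
  rw [map_mul, map_add, map_mul, hz', ← hy] at h1
  rw [map_mul]
  linear_combination h1

/-- The poles at `∞` of the finitely many functions that occur in a tensor have a common denominator
in `Q`. -/
theorem RationalPoint.exists_mul_mem_range (P : RationalPoint Fq Q) (p : Q ⊗[Fq] L) :
    ∃ d : Q, d ≠ 0 ∧ d ∈ P.valuationRing ∧
      ofFunction Fq L d * algebraMap _ (CurveField Fq Q L) p ∈ P.stalk L := by
  induction p using TensorProduct.induction_on with
  | zero => exact ⟨1, one_ne_zero, one_mem _, by rw [map_zero, mul_zero]; exact zero_mem _⟩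
  | tmul q l =>
    have key : ∃ d : Q, d ≠ 0 ∧ d ∈ P.valuationRing ∧ d * q ∈ P.valuationRing := by
      by_cases hq : q ∈ P.valuationRing
      · exact ⟨1, one_ne_zero, one_mem _, by rwa [one_mul]⟩
      · have hq0 : q ≠ 0 := by rintro rfl; exact hq P.valuationRing.zero_mem
        exact ⟨q⁻¹, inv_ne_zero hq0, (P.valuationRing.mem_or_inv_mem q).resolve_left hq,
          by rw [inv_mul_cancel₀ hq0]; exact one_mem _⟩
    obtain ⟨d, hd0, hd, hdq⟩ := key
    refine ⟨d, hd0, hd, ?_⟩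
    have : ofFunction Fq L d * algebraMap _ (CurveField Fq Q L) (q ⊗ₜ[Fq] l) =
        toCurveField L P.localRing ((⟨d * q, hdq⟩ : P.localRing) ⊗ₜ l) := by
      change algebraMap _ (CurveField Fq Q L) (d ⊗ₜ[Fq] (1 : L)) * _ =
        algebraMap _ (CurveField Fq Q L) ((d * q) ⊗ₜ[Fq] l)
      rw [← map_mul, Algebra.TensorProduct.tmul_mul_tmul, one_mul]
    rw [this]
    exact P.toCurveField_mem_stalk _
  | add x y hx hy =>
    obtain ⟨d, hd0, hd, h⟩ := hx
    obtain ⟨d', hd0', hd', h'⟩ := hy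
    refine ⟨d * d', mul_ne_zero hd0 hd0', mul_mem hd hd', ?_⟩
    have : ofFunction Fq L (d * d') * algebraMap _ (CurveField Fq Q L) (x + y) =
        ofFunction Fq L d' * (ofFunction Fq L d * algebraMap _ (CurveField Fq Q L) x) +
        ofFunction Fq L d * (ofFunction Fq L d' * algebraMap _ (CurveField Fq Q L) y) := by
      rw [map_mul, map_add]; ring
    rw [this]
    exact add_mem (mul_mem (P.ofFunction_mem_stalk hd') h) (mul_mem (P.ofFunction_mem_stalk hd) h')

/-- For a fraction `p / s`, let `d` and `d'` clear the poles of `p` and `s`; then `u = d d' s`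
works. Units take the role of nonzero denominators, because `CurveField` is treated only as a ring
of fractions. -/
theorem RationalPoint.exists_isUnit_mul_mem_stalk (P : RationalPoint Fq Q)
    (x : CurveField Fq Q L) : ∃ u ∈ P.stalk L, IsUnit u ∧ u * x ∈ P.stalk L := by
  obtain ⟨⟨p, s⟩, h3⟩ := IsLocalization.surj (nonZeroDivisors (Q ⊗[Fq] L)) x
  have hs : IsUnit (algebraMap (Q ⊗[Fq] L) (CurveField Fq Q L) s) := IsLocalization.map_units _ s
  obtain ⟨d, hd0, hd, h⟩ := P.exists_mul_mem_range p
  obtain ⟨d', hd0', hd', h'⟩ := P.exists_mul_mem_range (s : Q ⊗[Fq] L)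
  change x * algebraMap (Q ⊗[Fq] L) (CurveField Fq Q L) s =
    algebraMap (Q ⊗[Fq] L) (CurveField Fq Q L) p at h3
  generalize algebraMap (Q ⊗[Fq] L) (CurveField Fq Q L) s = s' at *
  generalize algebraMap (Q ⊗[Fq] L) (CurveField Fq Q L) p = p' at *
  refine ⟨ofFunction Fq L d * (ofFunction Fq L d' * s'),
    mul_mem (P.ofFunction_mem_stalk hd) h',
    (isUnit_ofFunction hd0).mul ((isUnit_ofFunction hd0').mul hs), ?_⟩
  have : ofFunction Fq L d * (ofFunction Fq L d' * s') * x =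
      ofFunction Fq L d' * (ofFunction Fq L d * p') := by
    rw [← h3]; ring
  rw [this]
  exact mul_mem (P.ofFunction_mem_stalk hd') h

theorem RationalPoint.exists_isUnit_smul_mem_span (P : RationalPoint Fq Q)
    {V ι : Type*} [AddCommGroup V] [Module (CurveField Fq Q L) V]
    (b : Module.Basis ι (CurveField Fq Q L) V) (v : V) :
    ∃ u : CurveField Fq Q L, IsUnit u ∧ u ∈ P.stalk L ∧
      u • v ∈ Submodule.span (P.stalk L) (Set.range b) := by
  have hv : v ∈ Submodule.span (CurveField Fq Q L) (Set.range b) := by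
    rw [b.span_eq]; exact Submodule.mem_top
  induction hv using Submodule.span_induction with
  | mem x hx => exact ⟨1, isUnit_one, one_mem _, by rw [one_smul]; exact Submodule.subset_span hx⟩
  | zero => exact ⟨1, isUnit_one, one_mem _, by rw [smul_zero]; exact zero_mem _⟩
  | add x y _ _ hx hy =>
    obtain ⟨u, hu, hus, h⟩ := hx
    obtain ⟨u', hu', hus', h'⟩ := hy
    refine ⟨u * u', hu.mul hu', mul_mem hus hus', ?_⟩
    rw [smul_add]
    refine add_mem ?_ ?_
    · rw [mul_comm, mul_smul]
      exact Submodule.smul_mem _ (⟨u', hus'⟩ : P.stalk L) h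
    · rw [mul_smul]
      exact Submodule.smul_mem _ (⟨u, hus⟩ : P.stalk L) h'
  | smul a x _ hx =>
    obtain ⟨u, hu, hus, h⟩ := hx
    obtain ⟨w, hws, hw, hwa⟩ := P.exists_isUnit_mul_mem_stalk a
    refine ⟨w * u, hw.mul hu, mul_mem hws hus, ?_⟩
    have : (w * u) • a • x = (w * a) • u • x := by
      rw [smul_smul, smul_smul]; congr 1; ring
    rw [this]
    exact Submodule.smul_mem _ (⟨w * a, hwa⟩ : P.stalk L) h

end Stalk

/-! ### Purity excludes vectors fixed by a linear power of `τ` -/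

section Purity

variable {Fq Q : Type u} [Field Fq] [Fintype Fq] [Field Q] [Algebra Fq Q]
  (P : RationalPoint Fq Q) {L : Type u} [Field L] [Algebra Fq L]

/-- A semilinear endomorphism of a vector space over the function field, considered over the local
ring at `∞`. -/
def restrictStalk {V : Type u} [AddCommGroup V] [Module (CurveField Fq Q L) V]
    (T : V →ₛₗ[frobCurveField Fq Q L] V) : V →ₛₗ[P.frobStalk L] V where
  toFun := T
  map_add' := map_add T
  map_smul' s x := T.map_smulₛₗ (s : CurveField Fq Q L) x

/-- Purity of a semilinear endomorphism of a vector space over the function field of `C_L`. -/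
def IsPureEndomorphism {V : Type u} [AddCommGroup V] [Module (CurveField Fq Q L) V] (r : ℕ)
    (T : V →ₛₗ[frobCurveField Fq Q L] V) : Prop :=
  ∃ (b : Module.Basis (Fin r) (CurveField Fq Q L) V) (N : Submodule (P.stalk L) V) (k l : ℕ),
    N = Submodule.span (P.stalk L) (Set.range b) ∧ 0 < k ∧ 0 < l ∧
    Function.Injective (iterateOn (restrictStalk P T) N l) ∧
    LinearMap.range (iterateOn (restrictStalk P T) N l) = P.twist N k

theorem isPure_iff {M : Type u} [AddCommGroup M] [Module (P.coordRing L) M] (r : ℕ)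
    (τ : Pullback (P.sigma L) M →ₗ[P.coordRing L] M) :
    IsPure P r τ ↔ IsPureEndomorphism P r (genericTau P τ) := Iff.rfl
variable {P}

theorem iterate_smul_ofFunction {V : Type u} [AddCommGroup V] [Module (CurveField Fq Q L) V]
    (T : V →ₛₗ[frobCurveField Fq Q L] V) (n : ℕ) (z : Q) (k : ℕ) (v : V) :
    T^[n] (ofFunction Fq L z ^ k • v) = ofFunction Fq L z ^ k • T^[n] v := by
  induction n with
  | zero => rfl
  | succ n ih =>
    rw [Function.iterate_succ_apply', ih, Function.iterate_succ_apply', map_smulₛₗ, map_pow,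
      frobCurveField_ofFunction]

/-- Over a finite field, no power of a pure endomorphism that is linear fixes a nonzero vector. -/
theorem IsPureEndomorphism.eq_zero_of_iterate_eq [Finite L] (hC : IsCurveFunctionField Fq Q)
    {V : Type u} [AddCommGroup V] [Module (CurveField Fq Q L) V] {r : ℕ}
    {T : V →ₛₗ[frobCurveField Fq Q L] V} (hpure : IsPureEndomorphism P r T) {m : ℕ} (hm : 0 < m)
    (hmq : ∀ x : L, x ^ Fintype.card Fq ^ m = x) {v : V} (hv : T^[m] v = v) : v = 0 := by
  obtain ⟨b, N, k, l, hN, hk, hl, -, hrange⟩ := hpure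
  obtain ⟨z, hz0, hz1, hz⟩ := P.exists_uniformizer hC
  set Z := ofFunction Fq L z with hZ
  have hZu : IsUnit Z := isUnit_ofFunction hz0
  have hzO : z ∈ P.valuationRing := (P.valuationRing.valuation_le_one_iff z).1 hz1.le
  have hσ : Function.Surjective (P.frobStalk L ^ l) := by
    rw [RingHom.coe_pow]
    exact (bijective_of_iterate_eq hm (P.frobStalk_iterate_eq hmq)).2.iterate l
  have hmem : ∀ n ∈ N, Z ^ k • T^[l] n ∈ N := fun n hn => by
    rw [← P.mem_twist_iff hz0 hz1 hz, ← hrange]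
    exact ⟨Pullback.mk _ ⟨n, hn⟩, iterateOn_mk _ _ _ _⟩
  let S : N → N := fun n => ⟨Z ^ k • T^[l] n, hmem n n.2⟩
  -- Purity identifies the range of `τ^l` with `z^{-k} N`, so `S = z^k τ^l` is onto; as `σ^l` is
  -- surjective, every element of the pullback is a pure tensor `1 ⊗ n'`.
  have hS : Function.Surjective S := by
    intro n
    obtain ⟨w, hw⟩ := (hZu.pow k).exists_right_inv
    have h1 : w • (n : V) ∈ P.twist N k := by
      rw [P.mem_twist_iff hz0 hz1 hz, smul_smul, hw, one_smul]
      exact n.2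
    rw [← hrange] at h1
    obtain ⟨p, hp⟩ := h1
    obtain ⟨n', rfl⟩ := Pullback.mk_surjective hσ p
    refine ⟨n', Subtype.val_injective ?_⟩
    change Z ^ k • T^[l] n' = n
    have h2 : T^[l] (n' : V) = w • n :=
      (iterateOn_mk _ _ _ _).symm.trans hp
    rw [h2, smul_smul, hw, one_smul]
  have hSj : ∀ j (n : N), ((S^[j] n : N) : V) =
      Z ^ (k * j) • T^[l * j] n := by
    intro j n
    induction j with
    | zero => simp
    | succ j ih =>
      rw [Function.iterate_succ_apply']
      change Z ^ k • T^[l] (S^[j] n : N).1 = _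
      rw [ih, iterate_smul_ofFunction, smul_smul, ← Function.iterate_add_apply,
        ← pow_add, Nat.mul_succ, Nat.mul_succ, add_comm k, add_comm l]
  have hlin : ∀ x, (frobCurveField Fq Q L)^[l * m] x = x := fun x => by
    rw [mul_comm]
    exact iterate_mul_eq (frobCurveField_iterate_eq hmq x) l
  let Tlin := linearIterate T (l * m) hlin
  have hTlin : ∀ x, T^[l * m] x = Tlin x := fun _ => rfl
  -- `S^m = z^(km) T^(lm)` is linear, since `σ^(lm)` is the identity.
  let θ : N →ₗ[P.stalk L] N :=
    { toFun := S^[m]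
      map_add' := fun x y => Subtype.val_injective (by
        change ((S^[m] (x + y) : N) : V) =
          (S^[m] x : N).1 + (S^[m] y : N).1
        rw [hSj, hSj, hSj, hTlin, hTlin, hTlin, Submodule.coe_add, map_add, smul_add])
      map_smul' := fun s x => Subtype.val_injective (by
        change ((S^[m] (s • x) : N) : V) =
          (s : CurveField Fq Q L) • (S^[m] x : N).1
        rw [hSj, hSj, hTlin, hTlin, Submodule.coe_smul, Subring.smul_def, map_smul,
          smul_comm]) }
  have : Module.Finite (P.stalk L) N :=
    Module.Finite.iff_fg.2 (hN ▸ Submodule.fg_span (Set.finite_range b))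
  let ζ : P.stalk L := ⟨Z, P.ofFunction_mem_stalk hzO⟩
  have hζ : ζ ^ (k * m) ∈ Ideal.jacobson (⊥ : Ideal (P.stalk L)) :=
    Ideal.pow_mem_of_mem _ (P.ofFunction_mem_jacobson hzO hz1) _ (Nat.mul_pos hk hm)
  have hinj := injective_sub_smul_of_surjective θ (show Function.Surjective θ from hS.iterate m) hζ
  -- The fixed vector need not lie in `N`, but a multiple by a unit `u` of the function field does.
  -- Linearity of `T^(lm)` gives `θ (u v) = z^(km) u v`, so `u v = 0`.
  obtain ⟨u, hu, hus, huv⟩ := P.exists_isUnit_smul_mem_span b v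
  rw [← hN] at huv
  have h0 : (⟨u • v, huv⟩ : N) = 0 := by
    apply hinj
    rw [map_zero, LinearMap.sub_apply, sub_eq_zero]
    refine Subtype.val_injective ((hSj m _).trans ?_)
    change Z ^ (k * m) • T^[l * m] (u • v) = Z ^ (k * m) • u • v
    rw [hTlin, map_smul, ← hTlin, mul_comm l, iterate_mul_eq hv]
  exact (IsUnit.smul_eq_zero hu).1 (congrArg Subtype.val h0)

variable {M : Type u} [AddCommGroup M] [Module (P.coordRing L) M]

theorem genericTau_iterate_tmul {τ : Pullback (P.sigma L) M →ₗ[P.coordRing L] M} (n : ℕ) (m : M) :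
    (genericTau P τ)^[n] (1 ⊗ₜ m) = 1 ⊗ₜ (τ.comp (Pullback.mk (P.sigma L)))^[n] m := by
  induction n with
  | zero => rfl
  | succ n ih =>
    rw [Function.iterate_succ_apply', ih, Function.iterate_succ_apply']
    refine (semilinearBaseChange_tmul _ _ _ _ _).trans ?_
    rw [map_one]
    rfl

theorem toCurveField_injective (B : Subalgebra Fq Q) :
    Function.Injective (toCurveField L B) := by
  refine (IsFractionRing.injective (Q ⊗[Fq] L) (CurveField Fq Q L)).comp ?_
  exact Module.Flat.rTensor_preserves_injective_linearMap (M := L) B.val.toLinearMap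
    Subtype.val_injective

/-- Tensoring the injection of `A_L` into the function field with the flat module `M` keeps it
injective. This carries vanishing on the generic fibre back to `M`. -/
theorem genericFibre_injective [Module.Flat (P.coordRing L) M] :
    Function.Injective (fun m : M => (1 : CurveField Fq Q L) ⊗ₜ[P.coordRing L] m) := by
  have h := Module.Flat.rTensor_preserves_injective_linearMap (M := M)
    (Algebra.linearMap (P.coordRing L) (CurveField Fq Q L)) (toCurveField_injective P.affineRing)
  intro m n hmn
  have h2 := @h (1 ⊗ₜ m) (1 ⊗ₜ n) (by
    rw [LinearMap.rTensor_tmul, LinearMap.rTensor_tmul, Algebra.linearMap_apply, map_one]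
    exact hmn)
  simpa using congrArg (TensorProduct.lid (P.coordRing L) M) h2

end Purity

/-! ### Separable isogenies over a finite field -/

section SeparableIsogenies

open nonZeroDivisors

variable {Fq Q : Type u} [Field Fq] [Fintype Fq] [Field Q] [Algebra Fq Q]
  {P : RationalPoint Fq Q} {L : Type u} [Field L] [Algebra Fq L] {c : P.affineRing →ₐ[Fq] L}

/-- The structure map of a motive as a semilinear map. -/
def PureAndersonMotive.semilinearTau (X : PureAndersonMotive P c) : X.M →ₛₗ[P.sigma L] X.M :=
  X.τ.comp (Pullback.mk (P.sigma L))

namespace MotiveHom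

variable {X Y Z : PureAndersonMotive P c}

theorem hom_semilinearTau (f : MotiveHom X Y) (x : X.M) :
    f.hom (X.semilinearTau x) = Y.semilinearTau (f.hom x) := by
  have h := LinearMap.congr_fun f.comm (Pullback.mk _ x)
  rw [LinearMap.comp_apply, LinearMap.comp_apply, Pullback.map_mk] at h
  exact h

/-- A linear map that commutes with the semilinear structure maps is a morphism. -/
def ofSemilinear (f : X.M →ₗ[P.coordRing L] Y.M)
    (h : ∀ x, f (X.semilinearTau x) = Y.semilinearTau (f x)) : MotiveHom X Y where
  hom := f
  comm := Pullback.hom_ext fun m => by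
    rw [LinearMap.comp_apply, LinearMap.comp_apply, Pullback.map_mk]
    exact h m

/-- This names the semilinear map behind `cokerTau`, so that it can be iterated and computed on
representatives. -/
theorem cokerTau_eq_lift (f : MotiveHom X Y) :
    ∃ φ : (Y.M ⧸ LinearMap.range f.hom) →ₛₗ[P.sigma L] (Y.M ⧸ LinearMap.range f.hom),
      f.cokerTau = Pullback.lift φ ∧
      ∀ y, φ (Submodule.Quotient.mk y) = Submodule.Quotient.mk (Y.semilinearTau y) :=
  ⟨_, rfl, fun _ => rfl⟩

theorem isTorsion_coker_iff (f : MotiveHom X Y) :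
    Module.IsTorsion (P.coordRing L) (Y.M ⧸ LinearMap.range f.hom) ↔
      ∀ y, ∃ s ∈ (P.coordRing L)⁰, s • y ∈ LinearMap.range f.hom := by
  constructor
  · intro h y
    obtain ⟨s, hs⟩ := @h (Submodule.Quotient.mk y)
    exact ⟨s, s.2, (Submodule.Quotient.mk_eq_zero _).1 hs⟩
  · intro h y
    obtain ⟨y, rfl⟩ := Submodule.Quotient.mk_surjective _ y
    obtain ⟨s, hs, h⟩ := h y
    exact ⟨⟨s, hs⟩, (Submodule.Quotient.mk_eq_zero _).2 h⟩

/-- For bijective `σ`, the linearization on the cokernel may be replaced by the semilinear map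
itself. The last two conditions are its injectivity and surjectivity, written on representatives. -/
theorem isSeparableIsogeny_iff (hσ : Function.Bijective (P.sigma L)) (f : MotiveHom X Y) :
    f.IsSeparableIsogeny ↔ Function.Injective f.hom ∧
      (∀ y, ∃ s ∈ (P.coordRing L)⁰, s • y ∈ LinearMap.range f.hom) ∧
      (∀ y, Y.semilinearTau y ∈ LinearMap.range f.hom → y ∈ LinearMap.range f.hom) ∧
      ∀ y, ∃ y', y - Y.semilinearTau y' ∈ LinearMap.range f.hom := by
  obtain ⟨φ, hφ, hφ'⟩ := f.cokerTau_eq_lift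
  rw [IsSeparableIsogeny, IsIsogeny, and_assoc, isTorsion_coker_iff, hφ,
    Pullback.lift_bijective_iff hσ]
  refine and_congr_right fun _ => and_congr_right fun _ => and_congr ?_ ?_
  · rw [injective_iff_map_eq_zero]
    constructor
    · intro h y hy
      rw [← Submodule.Quotient.mk_eq_zero]
      exact h _ ((hφ' y).trans ((Submodule.Quotient.mk_eq_zero _).2 hy))
    · intro h y hy
      obtain ⟨y, rfl⟩ := Submodule.Quotient.mk_surjective _ y
      rw [hφ', Submodule.Quotient.mk_eq_zero] at hy
      exact (Submodule.Quotient.mk_eq_zero _).2 (h y hy)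
  · constructor
    · intro h y
      obtain ⟨k, hk⟩ := h (Submodule.Quotient.mk y)
      obtain ⟨y', rfl⟩ := Submodule.Quotient.mk_surjective _ k
      exact ⟨y', (Submodule.Quotient.eq _).1 (hk.symm.trans (hφ' y'))⟩
    · intro h k
      obtain ⟨y, rfl⟩ := Submodule.Quotient.mk_surjective _ k
      obtain ⟨y', hy'⟩ := h y
      exact ⟨Submodule.Quotient.mk y', (hφ' y').trans ((Submodule.Quotient.eq _).2 hy').symm⟩

end MotiveHom

theorem RationalPoint.sigma_iterate_eq (P : RationalPoint Fq Q) {m : ℕ}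
    (hm : ∀ x : L, x ^ Fintype.card Fq ^ m = x) (x : P.coordRing L) : (P.sigma L)^[m] x = x :=
  frob_iterate_eq hm P.affineRing x

theorem sigma_bijective [Finite L] (P : RationalPoint Fq Q) :
    Function.Bijective (P.sigma L) := by
  obtain ⟨e, he, h⟩ := exists_pow_card_pow_eq Fq L
  exact bijective_of_iterate_eq he (P.sigma_iterate_eq h)

theorem SeparablyIsogenous.refl [Finite L] (X : PureAndersonMotive P c) :
    SeparablyIsogenous X X := by
  refine ⟨MotiveHom.ofSemilinear LinearMap.id fun _ => rfl, ?_⟩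
  rw [MotiveHom.isSeparableIsogeny_iff (sigma_bijective P)]
  exact ⟨fun _ _ h => h, fun y => ⟨1, one_mem _, _, rfl⟩, fun y _ => ⟨y, rfl⟩,
    fun y => ⟨0, _, rfl⟩⟩

theorem SeparablyIsogenous.trans [Finite L] {X Y Z : PureAndersonMotive P c}
    (hXY : SeparablyIsogenous X Y) (hYZ : SeparablyIsogenous Y Z) : SeparablyIsogenous X Z := by
  obtain ⟨f, hf⟩ := hXY
  obtain ⟨g, hg⟩ := hYZ
  rw [MotiveHom.isSeparableIsogeny_iff (sigma_bijective P)] at hf hg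
  obtain ⟨hf1, hf2, hf3, hf4⟩ := hf
  obtain ⟨hg1, hg2, hg3, hg4⟩ := hg
  refine ⟨MotiveHom.ofSemilinear (g.hom ∘ₗ f.hom) fun x => by
    rw [LinearMap.comp_apply, f.hom_semilinearTau, g.hom_semilinearTau]; rfl, ?_⟩
  rw [MotiveHom.isSeparableIsogeny_iff (sigma_bijective P)]
  change Function.Injective (g.hom ∘ₗ f.hom) ∧
    (∀ z, ∃ s ∈ (P.coordRing L)⁰, s • z ∈ LinearMap.range (g.hom ∘ₗ f.hom)) ∧
    (∀ z, Z.semilinearTau z ∈ LinearMap.range (g.hom ∘ₗ f.hom) →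
      z ∈ LinearMap.range (g.hom ∘ₗ f.hom)) ∧
    ∀ z, ∃ z', z - Z.semilinearTau z' ∈ LinearMap.range (g.hom ∘ₗ f.hom)
  refine ⟨hg1.comp hf1, fun z => ?_, fun z => ?_, fun z => ?_⟩
  · obtain ⟨s, hs, y, hy⟩ := hg2 z
    obtain ⟨t, ht, x, hx⟩ := hf2 y
    exact ⟨t * s, mul_mem ht hs, x, by rw [LinearMap.comp_apply, hx, map_smul, hy, mul_smul]⟩
  · rintro ⟨x, hx⟩
    obtain ⟨y, rfl⟩ := hg3 z ⟨f.hom x, hx⟩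
    rw [← g.hom_semilinearTau] at hx
    obtain ⟨x', rfl⟩ := hf3 y ⟨x, hg1 hx⟩
    exact ⟨x', rfl⟩
  · obtain ⟨z', y, hy⟩ := hg4 z
    obtain ⟨y', x, hx⟩ := hf4 y
    -- From `z - τ z' = g y` and `y - τ y' = f x` one obtains `z - τ (z' + g y') = g (f x)`.
    refine ⟨z' + g.hom y', x, ?_⟩
    rw [LinearMap.comp_apply, hx, map_sub, hy, map_add, g.hom_semilinearTau]
    abel

/-- Over a finite field, `1 - F` is injective for a power `F` of the structure map of a pure motive
that is linear. -/
theorem PureAndersonMotive.eq_zero_of_iterate_eq [Finite L] (hC : IsCurveFunctionField Fq Q)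
    (Y : PureAndersonMotive P c) {m : ℕ} (hm : 0 < m)
    (hmq : ∀ x : L, x ^ Fintype.card Fq ^ m = x) {y : Y.M}
    (hy : Y.semilinearTau^[m] y = y) : y = 0 := by
  have := Y.projective
  have h := ((isPure_iff P Y.r Y.τ).1 Y.pure).eq_zero_of_iterate_eq hC hm hmq
    (v := 1 ⊗ₜ y) ((genericTau_iterate_tmul m y).trans (congrArg _ hy))
  exact genericFibre_injective (h.trans (TensorProduct.tmul_zero _ _).symm)

/-- The reverse isogeny is `f⁻¹ ∘ (1 - τ^m)`, where `m` is such that `τ^m` is linear and trivial on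
the cokernel of `f`. -/
theorem SeparablyIsogenous.symm [Finite L] (hC : IsCurveFunctionField Fq Q)
    {X Y : PureAndersonMotive P c} (hXY : SeparablyIsogenous X Y) : SeparablyIsogenous Y X := by
  obtain ⟨f, hf⟩ := hXY
  let : Algebra P.affineRing (P.coordRing L) :=
    inferInstanceAs (Algebra P.affineRing (P.affineRing ⊗[Fq] L))
  have : Module.Finite Fq L := Module.Finite.of_finite
  have : Module.Finite P.affineRing (P.coordRing L) :=
    inferInstanceAs (Module.Finite P.affineRing (P.affineRing ⊗[Fq] L))
  have : Module.Flat P.affineRing (P.coordRing L) :=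
    inferInstanceAs (Module.Flat P.affineRing (P.affineRing ⊗[Fq] L))
  have := Y.finite
  have : Finite (Y.M ⧸ LinearMap.range f.hom) :=
    finite_of_isTorsion P.affineRing (fun r hr => hC.finite_quotient_span P.affineRing hr)
      hf.1.2
  obtain ⟨φ, hφ, hφ'⟩ := f.cokerTau_eq_lift
  have hφb : Function.Bijective φ := by
    rw [← Pullback.lift_bijective_iff (sigma_bijective P), ← hφ]
    exact hf.2
  obtain ⟨e, he, heq⟩ := exists_pow_card_pow_eq Fq L
  -- A common multiple of an exponent that trivializes Frobenius on `L` and of the order of the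
  -- permutation `φ` of the finite cokernel.
  obtain ⟨m, hm, hmq, hmφ⟩ : ∃ m : ℕ, 0 < m ∧ (∀ x : L, x ^ Fintype.card Fq ^ m = x) ∧
      ∀ k, φ^[m] k = k := by
    let π := Equiv.ofBijective φ hφb
    have hπ : ∀ k, φ^[orderOf π] k = k := fun k => by
      have h := Equiv.congr_fun (pow_orderOf_eq_one π) k
      rwa [Equiv.Perm.coe_pow] at h
    refine ⟨e * orderOf π, Nat.mul_pos he (orderOf_pos π), fun x => ?_, fun k => ?_⟩
    · rw [pow_mul]
      have h : (fun y : L => y ^ Fintype.card Fq ^ e)^[orderOf π] x = x :=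
        Function.iterate_fixed (heq x) _
      rwa [pow_iterate] at h
    · rw [mul_comm]
      exact iterate_mul_eq (hπ k) e
  obtain ⟨n, rfl⟩ := Nat.exists_eq_succ_of_ne_zero hm.ne'
  let T := Y.semilinearTau
  let F := linearIterate T (n + 1) (P.sigma_iterate_eq hmq)
  have hF : ∀ y, F y = T^[n + 1] y := fun _ => rfl
  let ψ : Y.M →ₗ[P.coordRing L] Y.M := LinearMap.id - F
  have hψ : ∀ y, ψ y = y - T^[n + 1] y := fun _ => rfl
  have hψT : ∀ y, ψ (T y) = T (ψ y) := fun y => by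
    rw [hψ, hψ, map_sub, (Function.Commute.iterate_self T (n + 1)).eq]
  have hψinj : Function.Injective ψ := by
    rw [injective_iff_map_eq_zero]
    intro y hy
    exact Y.eq_zero_of_iterate_eq hC hm hmq (sub_eq_zero.1 hy).symm
  have hφiter : ∀ j y, φ^[j] (Submodule.Quotient.mk y) = Submodule.Quotient.mk (T^[j] y) := by
    intro j y
    induction j with
    | zero => rfl
    | succ j ih => rw [Function.iterate_succ_apply', ih, hφ', Function.iterate_succ_apply']
  have hψrange : ∀ y, ψ y ∈ LinearMap.range f.hom := fun y =>
    (Submodule.Quotient.eq _).1 ((hmφ _).symm.trans (hφiter _ y))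
  choose g hg using hψrange
  have hfinj := hf.1.1
  let G : Y.M →ₗ[P.coordRing L] X.M :=
    { toFun := g
      map_add' := fun x y => hfinj (by rw [map_add, hg, hg, hg, map_add])
      map_smul' := fun s x => hfinj (by rw [map_smul, hg, hg, map_smul]; rfl) }
  have hG : ∀ y, f.hom (G y) = ψ y := hg
  have hfT : ∀ j x, f.hom (X.semilinearTau^[j] x) = T^[j] (f.hom x) := by
    intro j x
    induction j with
    | zero => rfl
    | succ j ih =>
      rw [Function.iterate_succ_apply', f.hom_semilinearTau, ih, Function.iterate_succ_apply']
  refine ⟨MotiveHom.ofSemilinear G fun y => hfinj ?_, ?_⟩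
  · rw [hG, f.hom_semilinearTau, hG]
    exact hψT y
  rw [MotiveHom.isSeparableIsogeny_iff (sigma_bijective P)]
  change Function.Injective G ∧ (∀ x, ∃ s ∈ (P.coordRing L)⁰, s • x ∈ LinearMap.range G) ∧
    (∀ x, X.semilinearTau x ∈ LinearMap.range G → x ∈ LinearMap.range G) ∧
    ∀ x, ∃ x', x - X.semilinearTau x' ∈ LinearMap.range G
  have hsub : ∀ x, x - X.semilinearTau^[n + 1] x = G (f.hom x) := fun x => hfinj (by
    rw [map_sub, hfT, hG, hψ])
  refine ⟨fun x y hxy => hψinj (by rw [← hG, ← hG, hxy]), fun x => ?_, ?_, fun x => ?_⟩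
  -- Torsion of the cokernel of `ψ = f ∘ G` passes to that of `G`, because `f` is injective.
  · obtain ⟨s, hs, hsψ⟩ := exists_nonZeroDivisor_smul_mem_range P.affineRing ψ hψinj
    obtain ⟨y, hy⟩ := hsψ (f.hom x)
    exact ⟨s, hs, y, hfinj (by rw [hG, hy, map_smul])⟩
  · rintro x ⟨y, hy⟩
    have hTx : T (f.hom x) = ψ y := by rw [← hG, hy, f.hom_semilinearTau]
    -- Split `x` as `(x - τ^(n+1) x) + τ^n (τ x)`: the first term is `G (f x)`, and `τ x = G y` by
    -- assumption.
    have h1 : x = G (f.hom x) + X.semilinearTau^[n] (G y) := by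
      rw [← hsub, Function.iterate_succ_apply, ← hy, sub_add_cancel]
    have hGT : ∀ j y, X.semilinearTau^[j] (G y) = G (T^[j] y) := by
      intro j
      induction j with
      | zero => exact fun _ => rfl
      | succ j ih =>
        intro y
        have h2 : X.semilinearTau (G y) = G (T y) := hfinj (by
          rw [f.hom_semilinearTau, hG, hG]; exact (hψT y).symm)
        rw [Function.iterate_succ_apply, h2, ih, Function.iterate_succ_apply]
    rw [hGT, ← map_add] at h1
    exact ⟨_, h1.symm⟩
  -- Modulo the range of `G`, `x` equals `τ^(n+1) x`, so `τ^n x` is a preimage of its class.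
  · refine ⟨X.semilinearTau^[n] x, f.hom x, ?_⟩
    rw [← hsub, Function.iterate_succ_apply']

end SeparableIsogenies

/-! ### The projective line, its point `∞` and its affine ring -/

section ProjectiveLine

open Polynomial IsDedekindDomain

variable (Fq : Type u) [Field Fq]

open scoped Classical in
/-- The local ring of the projective line at `∞`. -/
def inftyValuationRing : ValuationSubring (RatFunc Fq) :=
  (RatFunc.inftyValuation Fq).valuationSubring

variable {Fq}

open scoped Classical in
theorem inftyValuationRing_lt_one_iff (x : RatFunc Fq) :
    (inftyValuationRing Fq).valuation x < 1 ↔ RatFunc.inftyValuation Fq x < 1 :=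
  ((Valuation.isEquiv_valuation_valuationSubring (RatFunc.inftyValuation Fq)).lt_one_iff_lt_one).symm

open scoped Classical in
theorem mem_inftyValuationRing_iff (x : RatFunc Fq) :
    x ∈ inftyValuationRing Fq ↔ RatFunc.inftyValuation Fq x ≤ 1 := Iff.rfl

theorem X_notMem_inftyValuationRing : (RatFunc.X : RatFunc Fq) ∉ inftyValuationRing Fq := by
  classical
  rw [mem_inftyValuationRing_iff, RatFunc.inftyValuation.X, not_le, ← WithZero.exp_zero]
  exact WithZero.exp_lt_exp.2 one_pos

theorem isPlace_inftyValuationRing : IsPlace Fq (inftyValuationRing Fq) := by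
  classical
  refine ⟨fun h => X_notMem_inftyValuationRing (Fq := Fq) (by rw [h]; trivial), fun a => ?_⟩
  rw [mem_inftyValuationRing_iff, RatFunc.algebraMap_eq_C]
  by_cases ha : a = 0
  · simp [ha]
  · rw [RatFunc.inftyValuation.C _ ha]

theorem exists_sub_lt_one (x : RatFunc Fq) (hx : x ∈ inftyValuationRing Fq) :
    ∃ a : Fq, (inftyValuationRing Fq).valuation (x - algebraMap Fq _ a) < 1 := by
  classical
  simp only [inftyValuationRing_lt_one_iff]
  rw [mem_inftyValuationRing_iff] at hx
  by_cases hx0 : x = 0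
  · exact ⟨0, by simp [hx0]⟩
  have hq : x.denom ≠ 0 := x.denom_ne_zero
  have hdeg : x.num.natDegree ≤ x.denom.natDegree := by
    rw [RatFunc.inftyValuation_apply, RatFunc.inftyValuation_of_nonzero Fq hx0,
      ← WithZero.exp_zero, WithZero.exp_le_exp, RatFunc.intDegree] at hx
    omega
  set n := x.denom.natDegree with hn
  -- This is the value of `x` at `∞`: the numerator has degree at most `n`, and subtracting `a`
  -- times the denominator removes the coefficient in degree `n`.
  set a := x.num.coeff n / x.denom.leadingCoeff with ha
  refine ⟨a, ?_⟩
  have hsub : x - algebraMap Fq _ a = algebraMap Fq[X] (RatFunc Fq) (x.num - C a * x.denom) /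
      algebraMap Fq[X] (RatFunc Fq) x.denom := by
    have hq' : algebraMap Fq[X] (RatFunc Fq) x.denom ≠ 0 := by simpa using hq
    rw [eq_div_iff hq', sub_mul, map_sub, map_mul, RatFunc.algebraMap_eq_C, RatFunc.algebraMap_C]
    congr 1
    exact ((div_eq_iff hq').1 (RatFunc.num_div_denom x)).symm
  rw [hsub]
  by_cases hr : x.num - C a * x.denom = 0
  · rw [hr]; simp
  have hlt : (x.num - C a * x.denom).natDegree < n := by
    have : (x.num - C a * x.denom).degree < n := by
      rw [degree_lt_iff_coeff_zero]
      intro m hm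
      rcases hm.eq_or_lt with rfl | hm
      · rw [coeff_sub, coeff_C_mul, ha]
        change _ - _ * x.denom.leadingCoeff = 0
        rw [div_mul_cancel₀ _ (leadingCoeff_ne_zero.2 hq), sub_self]
      · rw [coeff_sub, coeff_C_mul, coeff_eq_zero_of_natDegree_lt (hdeg.trans_lt hm),
          coeff_eq_zero_of_natDegree_lt hm]
        simp
    rwa [natDegree_lt_iff_degree_lt hr]
  rw [map_div₀, RatFunc.inftyValuation_apply, RatFunc.inftyValuation_apply,
    RatFunc.inftyValuation.polynomial Fq hr, RatFunc.inftyValuation.polynomial Fq hq,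
    ← WithZero.exp_sub, ← WithZero.exp_zero, WithZero.exp_lt_exp]
  omega

variable (Fq) in
/-- The point `∞` of the projective line. -/
def inftyPoint : RationalPoint Fq (RatFunc Fq) where
  valuationRing := inftyValuationRing Fq
  isPlace := isPlace_inftyValuationRing
  residue := exists_sub_lt_one

theorem inv_X_isUniformizer : (inftyPoint Fq).valuationRing.valuation (RatFunc.X⁻¹) < 1 ∧
    ∀ w, (inftyPoint Fq).valuationRing.valuation w < 1 →
      (inftyPoint Fq).valuationRing.valuation w ≤
        (inftyPoint Fq).valuationRing.valuation RatFunc.X⁻¹ := by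
  classical
  have hX : RatFunc.inftyValuation Fq RatFunc.X⁻¹ = WithZero.exp (-1) := by
    rw [map_inv₀, RatFunc.inftyValuation.X, WithZero.exp_neg]
  refine ⟨?_, fun w hw => ?_⟩
  · refine (inftyValuationRing_lt_one_iff _).2 ?_
    rw [hX, ← WithZero.exp_zero]
    exact WithZero.exp_lt_exp.2 (by norm_num)
  · have h1 := (inftyValuationRing_lt_one_iff w).1 hw
    refine ((Valuation.isEquiv_valuation_valuationSubring (RatFunc.inftyValuation Fq)) _ _).1 ?_
    rw [hX]
    by_cases hw0 : w = 0
    · rw [hw0, map_zero]; exact zero_le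
    rw [RatFunc.inftyValuation_apply, RatFunc.inftyValuation_of_nonzero Fq hw0] at h1 ⊢
    rw [← WithZero.exp_zero, WithZero.exp_lt_exp] at h1
    rw [WithZero.exp_le_exp]
    omega

/-- A place where `X` is not integral is trivial on constants and has `|X| > 1`, so its valuation is
equivalent to the degree valuation and the place is `∞`. -/
theorem polynomial_mem_affineRing (p : Fq[X]) :
    algebraMap Fq[X] (RatFunc Fq) p ∈ (inftyPoint Fq).affineRing := by
  classical
  have hX : (RatFunc.X : RatFunc Fq) ∈ (inftyPoint Fq).affineRing := by
    intro v hv hne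
    by_contra hXv
    have : v.valuation.IsTrivialOn Fq := ⟨fun a ha => by
      have h1 := (v.valuation_le_one_iff _).2 (hv.2 a)
      have h2 := (v.valuation_le_one_iff _).2 (hv.2 a⁻¹)
      rw [map_inv₀, map_inv₀] at h2
      refine le_antisymm h1 ?_
      exact (inv_le_one₀ (zero_lt_iff.2 ((Valuation.ne_zero_iff _).2 (by simpa using ha)))).1 h2⟩
    have h1 : 1 < v.valuation RatFunc.X := not_le.1 fun h => hXv ((v.valuation_le_one_iff _).1 h)
    have h2 := RatFunc.valuation_isEquiv_inftyValuation_of_one_lt_valuation_X h1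
    rw [Valuation.isEquiv_iff_valuationSubring, ValuationSubring.valuationSubring_valuation] at h2
    exact hne h2
  have h := (aeval (⟨RatFunc.X, hX⟩ : (inftyPoint Fq).affineRing) p).2
  have h3 : ((aeval (⟨RatFunc.X, hX⟩ : (inftyPoint Fq).affineRing) p :
      (inftyPoint Fq).affineRing) : RatFunc Fq) = aeval (RatFunc.X : RatFunc Fq) p :=
    (aeval_algHom_apply (inftyPoint Fq).affineRing.val _ p).symm
  rw [h3, ← RatFunc.algebraMap_X, aeval_algebraMap_apply, aeval_X_left_apply] at h
  exact h

/-- Each maximal ideal of `Fq[X]` gives a place where `X` is integral, thus one other than `∞`; a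
rational function integral at all of these is a polynomial. -/
theorem exists_polynomial_of_mem_affineRing {x : RatFunc Fq} (hx : x ∈ (inftyPoint Fq).affineRing) :
    ∃ p : Fq[X], algebraMap Fq[X] (RatFunc Fq) p = x := by
  refine HeightOneSpectrum.mem_integers_of_valuation_le_one (RatFunc Fq) x fun w => ?_
  let v := (w.valuation (RatFunc Fq)).valuationSubring
  have hXv : (RatFunc.X : RatFunc Fq) ∈ v := by
    rw [← RatFunc.algebraMap_X]
    exact w.valuation_le_one X
  refine hx v ⟨fun htop => ?_, fun a => ?_⟩ fun h => ?_
  · obtain ⟨π, hπ⟩ := w.valuation_exists_uniformizer (RatFunc Fq)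
    have h : π⁻¹ ∈ v := by rw [htop]; trivial
    have h2 : w.valuation (RatFunc Fq) π⁻¹ ≤ 1 := h
    rw [map_inv₀, hπ, ← WithZero.exp_neg, ← WithZero.exp_zero, WithZero.exp_le_exp] at h2
    norm_num at h2
  · rw [RatFunc.algebraMap_eq_C, ← RatFunc.algebraMap_C]
    exact w.valuation_le_one (C a)
  · rw [h] at hXv
    exact X_notMem_inftyValuationRing hXv

/-- The coordinate ring of the affine line. -/
def affineRingEquiv : Fq[X] ≃ₐ[Fq] (inftyPoint Fq).affineRing :=
  AlgEquiv.ofBijective ((IsScalarTower.toAlgHom Fq Fq[X] (RatFunc Fq)).codRestrict _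
    polynomial_mem_affineRing) ⟨fun p q h =>
      RatFunc.algebraMap_injective Fq (congrArg Subtype.val h), fun x => by
      obtain ⟨p, hp⟩ := exists_polynomial_of_mem_affineRing x.2
      exact ⟨p, Subtype.val_injective hp⟩⟩

theorem coe_affineRingEquiv (p : Fq[X]) :
    (affineRingEquiv p : RatFunc Fq) = algebraMap Fq[X] (RatFunc Fq) p := rfl

variable (Fq) in
/-- The characteristic `A = Fq[t] → Fq(γ)`, `t ↦ 0`. -/
def zeroCharacteristic : (inftyPoint Fq).affineRing →ₐ[Fq] RatFunc Fq :=
  ((Algebra.ofId Fq (RatFunc Fq)).comp (aeval (0 : Fq))).comp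
    (affineRingEquiv (Fq := Fq)).symm.toAlgHom

theorem zeroCharacteristic_affineRingEquiv (p : Fq[X]) :
    zeroCharacteristic Fq (affineRingEquiv p) = algebraMap Fq _ (p.coeff 0) := by
  change algebraMap Fq (RatFunc Fq) (aeval 0 (affineRingEquiv.symm (affineRingEquiv p))) = _
  rw [AlgEquiv.symm_apply_apply, ← coeff_zero_eq_aeval_zero]

end ProjectiveLine

/-! ### Generators of a pullback -/

section GeneratingFamilies

variable {R : Type*} [CommRing R] {σ : R →+* R} {N : Type*} [AddCommGroup N] [Module R N]

theorem Pullback.exists_sum_smul_mk {n : ℕ} {e : Fin n → N}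
    (he : Submodule.span R (Set.range e) = ⊤) (p : Pullback σ N) :
    ∃ s : Fin n → R, p = ∑ i, s i • Pullback.mk σ (e i) := by
  induction p using Pullback.induction with
  | h0 => exact ⟨0, by simp⟩
  | ht a m =>
    obtain ⟨r, rfl⟩ := (Submodule.mem_span_range_iff_exists_fun R).1
      (he ▸ Submodule.mem_top : m ∈ Submodule.span R (Set.range e))
    refine ⟨fun i => a * σ (r i), ?_⟩
    rw [Pullback.tmul_eq_smul_mk, map_sum, Finset.smul_sum]
    refine Finset.sum_congr rfl fun i _ => ?_
    rw [Pullback.mk_smul, mul_smul]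
  | ha x y hx hy =>
    obtain ⟨s, rfl⟩ := hx
    obtain ⟨t, rfl⟩ := hy
    exact ⟨s + t, by simp only [Pi.add_apply, add_smul, Finset.sum_add_distrib]⟩

end GeneratingFamilies

/-! ### A matrix criterion for purity in rank two -/

section PurityCriterion

variable {Fq Q : Type u} [Field Fq] [Fintype Fq] [Field Q] [Algebra Fq Q]
  (P : RationalPoint Fq Q) {L : Type u} [Field L] [Algebra Fq L]

/-- An endomorphism of a plane whose square is `z⁻¹` times an automorphism of a lattice, with a
uniformizer `z`, is pure. -/
theorem isPureEndomorphism_of_sq {z : Q} (hz0 : z ≠ 0) (hz1 : P.valuationRing.valuation z < 1)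
    (hz : ∀ w, P.valuationRing.valuation w < 1 →
      P.valuationRing.valuation w ≤ P.valuationRing.valuation z)
    {V : Type u} [AddCommGroup V] [Module (CurveField Fq Q L) V]
    (T : V →ₛₗ[frobCurveField Fq Q L] V) (b : Module.Basis (Fin 2) (CurveField Fq Q L) V)
    (u₀₀ u₀₁ u₁₀ u₁₁ w : P.stalk L)
    (h₀ : ofFunction Fq L z • T (T (b 0)) = u₀₀ • b 0 + u₁₀ • b 1)
    (h₁ : ofFunction Fq L z • T (T (b 1)) = u₀₁ • b 0 + u₁₁ • b 1)
    (hdet : w * (u₀₀ * u₁₁ - u₀₁ * u₁₀) = 1) : IsPureEndomorphism P 2 T := by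
  let N := Submodule.span (P.stalk L) (Set.range b)
  let e : Fin 2 → N := fun i => ⟨b i, Submodule.subset_span ⟨i, rfl⟩⟩
  have he : Submodule.span (P.stalk L) (Set.range e) = ⊤ :=
    Submodule.map_injective_of_injective N.subtype_injective (by
      rw [Submodule.map_span, ← Set.range_comp, Submodule.map_subtype_top]; rfl)
  set Z := ofFunction Fq L z with hZ
  have hZu : IsUnit Z := isUnit_ofFunction hz0
  have hsum : ∀ s : Fin 2 → P.stalk L,
      Z • iterateOn (restrictStalk P T) N 2 (∑ i, s i • Pullback.mk _ (e i)) =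
      (s 0 * u₀₀ + s 1 * u₀₁) • b 0 + (s 0 * u₁₀ + s 1 * u₁₁) • b 1 := fun s => by
    rw [Fin.sum_univ_two, map_add, map_smul, map_smul, iterateOn_mk, iterateOn_mk]
    change Z • (s 0 • T (T (b 0)) + s 1 • T (T (b 1))) = _
    rw [smul_add, smul_comm, smul_comm Z (s 1), h₀, h₁]
    module
  refine ⟨b, N, 1, 2, rfl, one_pos, two_pos, ?_, ?_⟩
  · rw [injective_iff_map_eq_zero]
    intro p hp
    obtain ⟨s, rfl⟩ := Pullback.exists_sum_smul_mk he p
    have h := hsum s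
    rw [hp, smul_zero] at h
    have hli := LinearIndependent.pair_iff.1
      (show LinearIndependent (CurveField Fq Q L) ![b 0, b 1] by
        convert b.linearIndependent using 1
        ext i; fin_cases i <;> rfl) _ _ h.symm
    have e0 : s 0 * u₀₀ + s 1 * u₀₁ = 0 := Subtype.val_injective hli.1
    have e1 : s 0 * u₁₀ + s 1 * u₁₁ = 0 := Subtype.val_injective hli.2
    have s0 : s 0 = 0 := by
      -- Cramer's rule: `w` is the inverse of the determinant.
      linear_combination w * u₁₁ * e0 - w * u₀₁ * e1 - s 0 * hdet
    have s1 : s 1 = 0 := by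
      linear_combination w * u₀₀ * e1 - w * u₁₀ * e0 - s 1 * hdet
    rw [Fin.sum_univ_two, s0, s1, zero_smul, zero_smul, add_zero]
  · ext x
    rw [P.mem_twist_iff hz0 hz1 hz, pow_one]
    constructor
    · rintro ⟨p, rfl⟩
      obtain ⟨s, rfl⟩ := Pullback.exists_sum_smul_mk he p
      rw [hsum]
      exact add_mem (Submodule.smul_mem _ _ (e 0).2) (Submodule.smul_mem _ _ (e 1).2)
    · intro hx
      obtain ⟨n, hn⟩ := (Submodule.mem_span_range_iff_exists_fun (P.stalk L)).1 hx
      -- The inverse matrix, `w` times the adjugate, applied to the coordinates of `z x`.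
      let s : Fin 2 → P.stalk L :=
        ![w * (u₁₁ * n 0 - u₀₁ * n 1), w * (u₀₀ * n 1 - u₁₀ * n 0)]
      refine ⟨∑ i, s i • Pullback.mk _ (e i), hZu.smul_left_cancel.1 ?_⟩
      have hn0 : s 0 * u₀₀ + s 1 * u₀₁ = n 0 := by
        change w * (u₁₁ * n 0 - u₀₁ * n 1) * u₀₀ + w * (u₀₀ * n 1 - u₁₀ * n 0) * u₀₁ = n 0
        linear_combination n 0 * hdet
      have hn1 : s 0 * u₁₀ + s 1 * u₁₁ = n 1 := by
        change w * (u₁₁ * n 0 - u₀₁ * n 1) * u₁₀ + w * (u₀₀ * n 1 - u₁₀ * n 0) * u₁₁ = n 1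
        linear_combination n 1 * hdet
      rw [hsum, hn0, hn1, ← hn, Fin.sum_univ_two]

end PurityCriterion

/-! ### The ring `Fq(γ)[t]`, evaluation at `t = 0`, and `q`-th powers -/

section AffineLine

open Polynomial nonZeroDivisors

variable (Fq : Type u) [Field Fq]

/-- The coordinate ring `Fq(γ)[t]`. -/
abbrev LineRing : Type u := (inftyPoint Fq).coordRing (RatFunc Fq)

variable {Fq} in
/-- The simple tensor `a ⊗ x` in `A_L`. -/
def lineTmul (a : (inftyPoint Fq).affineRing) (x : RatFunc Fq) : LineRing Fq :=
  ((inftyPoint Fq).coordRingEquiv (RatFunc Fq)).symm (a ⊗ₜ[Fq] x)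

/-- The coordinate `t` of the affine line. -/
def lineCoord : LineRing Fq := lineTmul (affineRingEquiv X) 1

/-- Evaluation at `t = 0`. -/
def evalZero : LineRing Fq →+* RatFunc Fq :=
  (Algebra.TensorProduct.lift (zeroCharacteristic Fq) (AlgHom.id Fq (RatFunc Fq))
    fun _ _ => Commute.all _ _).toRingHom

variable {Fq}

theorem lineRing_induction {p : LineRing Fq → Prop} (h0 : p 0)
    (ht : ∀ f x, p (lineTmul (affineRingEquiv f) x)) (ha : ∀ x y, p x → p y → p (x + y))
    (x : LineRing Fq) : p x :=
  TensorProduct.induction_on (motive := p) x h0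
    (fun a x => by obtain ⟨f, rfl⟩ := affineRingEquiv.surjective a; exact ht f x) ha

theorem evalZero_lineTmul (f : Fq[X]) (x : RatFunc Fq) :
    evalZero Fq (lineTmul (affineRingEquiv f) x) = algebraMap Fq _ (f.coeff 0) * x := by
  rw [← zeroCharacteristic_affineRingEquiv]
  rfl

theorem evalZero_lineCoord : evalZero Fq (lineCoord Fq) = 0 := by
  rw [lineCoord, evalZero_lineTmul, coeff_X_zero, map_zero, zero_mul]

theorem algebraMap_lineRing (x : RatFunc Fq) : algebraMap _ (LineRing Fq) x = lineTmul 1 x := rfl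

theorem lineTmul_mul (a b : (inftyPoint Fq).affineRing) (x y : RatFunc Fq) :
    lineTmul a x * lineTmul b y = lineTmul (a * b) (x * y) :=
  Algebra.TensorProduct.tmul_mul_tmul a b x y

theorem lineTmul_add (a b : (inftyPoint Fq).affineRing) (x : RatFunc Fq) :
    lineTmul (a + b) x = lineTmul a x + lineTmul b x :=
  TensorProduct.add_tmul a b x

theorem lineTmul_algebraMap (a : Fq) (x : RatFunc Fq) :
    lineTmul (algebraMap Fq _ a) x = lineTmul 1 (algebraMap Fq _ a * x) := by
  rw [Algebra.algebraMap_eq_smul_one, ← Algebra.smul_def]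
  exact TensorProduct.smul_tmul a _ x

theorem evalZero_algebraMap (x : RatFunc Fq) : evalZero Fq (algebraMap _ (LineRing Fq) x) = x := by
  rw [algebraMap_lineRing, ← map_one affineRingEquiv, evalZero_lineTmul]
  simp

/-- On simple tensors this is `f = f(0) + t · f.divX`. It makes `t` a generator of the kernel of
evaluation at zero. -/
theorem exists_eq_evalZero_add (x : LineRing Fq) :
    ∃ y, x = algebraMap _ (LineRing Fq) (evalZero Fq x) + lineCoord Fq * y := by
  induction x using lineRing_induction with
  | h0 => exact ⟨0, by simp⟩
  | ht f x =>
    refine ⟨lineTmul (affineRingEquiv f.divX) x, ?_⟩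
    rw [evalZero_lineTmul, algebraMap_lineRing, ← lineTmul_algebraMap, lineCoord, lineTmul_mul,
      one_mul, ← lineTmul_add, ← map_mul, ← affineRingEquiv.commutes, ← map_add]
    congr 2
    rw [add_comm]
    exact (X_mul_divX_add f).symm
  | ha x y hx hy =>
    obtain ⟨x', hx⟩ := hx
    obtain ⟨y', hy⟩ := hy
    refine ⟨x' + y', ?_⟩
    rw [map_add, map_add]
    linear_combination hx + hy

theorem exists_eq_lineCoord_mul {x : LineRing Fq} (hx : evalZero Fq x = 0) :
    ∃ y, x = lineCoord Fq * y := by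
  obtain ⟨y, hy⟩ := exists_eq_evalZero_add x
  exact ⟨y, by rwa [hx, map_zero, zero_add] at hy⟩

theorem lineCoord_mem_nonZeroDivisors : lineCoord Fq ∈ (LineRing Fq)⁰ :=
  algebraMap_mem_nonZeroDivisors_of_flat (S := (inftyPoint Fq).affineRing ⊗[Fq] RatFunc Fq)
    ((map_ne_zero_iff _ affineRingEquiv.injective).2 (X_ne_zero (R := Fq)))

theorem charIdeal_zeroCharacteristic_le :
    charIdeal (inftyPoint Fq) (zeroCharacteristic Fq) ≤ Ideal.span {lineCoord Fq} := by
  refine Ideal.span_le.2 ?_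
  rintro _ ⟨a, rfl⟩
  obtain ⟨f, rfl⟩ := affineRingEquiv.surjective a
  obtain ⟨y, hy⟩ := exists_eq_lineCoord_mul (x :=
    lineTmul (affineRingEquiv f) 1 - lineTmul (affineRingEquiv 1)
      (zeroCharacteristic Fq (affineRingEquiv f))) (by
    rw [map_sub, evalZero_lineTmul, evalZero_lineTmul, zeroCharacteristic_affineRingEquiv]
    simp)
  rw [map_one] at hy
  exact Ideal.mem_span_singleton.2 ⟨y, hy⟩

variable [Fintype Fq]

variable (Fq) in
/-- The endomorphism `σ` of `A_L`. -/
abbrev lineSigma : LineRing Fq →+* LineRing Fq := (inftyPoint Fq).sigma (RatFunc Fq)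

theorem lineSigma_lineTmul (a : (inftyPoint Fq).affineRing) (x : RatFunc Fq) :
    lineSigma Fq (lineTmul a x) = lineTmul a (x ^ Fintype.card Fq) := rfl

theorem lineSigma_lineCoord : lineSigma Fq (lineCoord Fq) = lineCoord Fq := by
  rw [lineCoord, lineSigma_lineTmul, one_pow]

theorem evalZero_lineSigma (x : LineRing Fq) :
    evalZero Fq (lineSigma Fq x) = evalZero Fq x ^ Fintype.card Fq := by
  induction x using lineRing_induction with
  | h0 => rw [map_zero, map_zero, zero_pow Fintype.card_ne_zero]
  | ht f x =>
    rw [lineSigma_lineTmul, evalZero_lineTmul, evalZero_lineTmul, mul_pow, ← map_pow,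
      FiniteField.pow_card]
  | ha x y hx hy =>
    rw [map_add, map_add, hx, hy, map_add]
    exact ((FiniteField.frobeniusAlgHom Fq (RatFunc Fq)).map_add _ _).symm

/-- The degrees of `a^q` and `γ b^q` differ modulo `q`, so the terms cannot cancel unless both
vanish. The asymmetry rests on this imperfection of `L`. -/
theorem eq_zero_of_pow_add_X_mul_pow_eq_zero {a b : RatFunc Fq}
    (h : a ^ Fintype.card Fq + RatFunc.X * b ^ Fintype.card Fq = 0) : b = 0 := by
  by_contra hb
  have hq := Fintype.one_lt_card (α := Fq)
  have hpow : ∀ (x : RatFunc Fq) (n : ℕ), x ≠ 0 → (x ^ n).intDegree = n * x.intDegree := by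
    intro x n hx
    induction n with
    | zero => simp
    | succ n ih =>
      rw [pow_succ, RatFunc.intDegree_mul (pow_ne_zero _ hx) hx, ih]
      push_cast; ring
  have hbq := pow_ne_zero (Fintype.card Fq) hb
  have ha : a ≠ 0 := by
    rintro rfl
    rw [zero_pow Fintype.card_ne_zero, zero_add] at h
    exact mul_ne_zero RatFunc.X_ne_zero hbq h
  have h1 := congrArg RatFunc.intDegree (eq_neg_of_add_eq_zero_left h)
  rw [RatFunc.intDegree_neg, RatFunc.intDegree_mul RatFunc.X_ne_zero hbq, hpow _ _ ha, hpow _ _ hb,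
    RatFunc.intDegree_X] at h1
  have h2 : (Fintype.card Fq : ℤ) ∣ 1 := ⟨a.intDegree - b.intDegree, by rw [mul_sub, h1]; ring⟩
  have h3 := Int.le_of_dvd one_pos h2
  omega

end AffineLine

/-! ### A family of pure motives of rank two and dimension one -/

section RankTwoMotives

open nonZeroDivisors

variable {Fq : Type u} [Field Fq] [Fintype Fq]

/-- The semilinear endomorphism `e₁ ↦ e₁ + β e₂`, `e₂ ↦ γ δ e₁` of `A_L²`. -/
def pairTau (β δ : LineRing Fq) :
    (Fin 2 → LineRing Fq) →ₛₗ[lineSigma Fq] (Fin 2 → LineRing Fq) where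
  toFun v := ![lineSigma Fq (v 0) +
    algebraMap (RatFunc Fq) (LineRing Fq) RatFunc.X * δ * lineSigma Fq (v 1), β * lineSigma Fq (v 0)]
  map_add' v w := by
    ext i; fin_cases i
    · simp; ring
    · simp; ring
  map_smul' s v := by
    ext i; fin_cases i
    · simp; ring
    · simp; ring

theorem pairTau_zero (β δ : LineRing Fq) (v : Fin 2 → LineRing Fq) :
    pairTau β δ v 0 = lineSigma Fq (v 0) +
      algebraMap (RatFunc Fq) (LineRing Fq) RatFunc.X * δ * lineSigma Fq (v 1) := rfl

theorem pairTau_one (β δ : LineRing Fq) (v : Fin 2 → LineRing Fq) :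
    pairTau β δ v 1 = β * lineSigma Fq (v 0) := rfl

/-- Factorizations of the coordinate `t` into factors that are fixed by `σ` and have at most a
simple pole at `∞`. -/
structure IsCoordFactorization (β δ : LineRing Fq) : Prop where
  mul_eq : β * δ = lineCoord Fq
  sigma_left : lineSigma Fq β = β
  sigma_right : lineSigma Fq δ = δ
  stalk_left : ofFunction Fq (RatFunc Fq) RatFunc.X⁻¹ *
    algebraMap (LineRing Fq) (CurveField Fq (RatFunc Fq) (RatFunc Fq)) β ∈
      (inftyPoint Fq).stalk (RatFunc Fq)
  stalk_right : ofFunction Fq (RatFunc Fq) RatFunc.X⁻¹ *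
    algebraMap (LineRing Fq) (CurveField Fq (RatFunc Fq) (RatFunc Fq)) δ ∈
      (inftyPoint Fq).stalk (RatFunc Fq)

theorem algebraMap_lineCoord :
    algebraMap (LineRing Fq) (CurveField Fq (RatFunc Fq) (RatFunc Fq)) (lineCoord Fq) =
      ofFunction Fq (RatFunc Fq) RatFunc.X := by
  rw [← RatFunc.algebraMap_X]
  rfl

theorem ofFunction_inv_mul_lineCoord : ofFunction Fq (RatFunc Fq) RatFunc.X⁻¹ *
    algebraMap (LineRing Fq) (CurveField Fq (RatFunc Fq) (RatFunc Fq)) (lineCoord Fq) = 1 := by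
  rw [algebraMap_lineCoord, ← map_mul, inv_mul_cancel₀ RatFunc.X_ne_zero, map_one]

theorem inv_X_mem : (RatFunc.X⁻¹ : RatFunc Fq) ∈ (inftyPoint Fq).valuationRing :=
  ((inftyPoint Fq).valuationRing.valuation_le_one_iff _).1 inv_X_isUniformizer.1.le

theorem isCoordFactorization_one_lineCoord : IsCoordFactorization 1 (lineCoord Fq) where
  mul_eq := one_mul _
  sigma_left := map_one _
  sigma_right := lineSigma_lineCoord
  stalk_left := by
    rw [map_one, mul_one]
    exact (inftyPoint Fq).ofFunction_mem_stalk inv_X_mem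
  stalk_right := by
    rw [ofFunction_inv_mul_lineCoord]
    exact one_mem _

theorem IsCoordFactorization.symm {β δ : LineRing Fq} (h : IsCoordFactorization β δ) :
    IsCoordFactorization δ β :=
  ⟨by rw [mul_comm, h.mul_eq], h.sigma_right, h.sigma_left, h.stalk_right, h.stalk_left⟩

theorem IsCoordFactorization.left_mem {β δ : LineRing Fq} (h : IsCoordFactorization β δ) :
    β ∈ (LineRing Fq)⁰ :=
  (mul_mem_nonZeroDivisors.1 (h.mul_eq ▸ lineCoord_mem_nonZeroDivisors)).1

theorem algebraMap_X_mul_algebraMap_inv :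
    algebraMap (RatFunc Fq) (LineRing Fq) RatFunc.X *
      algebraMap (RatFunc Fq) (LineRing Fq) RatFunc.X⁻¹ = 1 := by
  rw [← map_mul, mul_inv_cancel₀ RatFunc.X_ne_zero, map_one]

theorem span_range_single (R : Type*) [CommRing R] :
    Submodule.span R (Set.range fun i : Fin 2 => (Pi.single i 1 : Fin 2 → R)) = ⊤ := by
  convert (Pi.basisFun R (Fin 2)).span_eq using 3
  ext i : 1
  simp

variable {β δ : LineRing Fq}

theorem pairTau_single_zero (β δ : LineRing Fq) : pairTau β δ (Pi.single 0 1) = ![1, β] := by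
  ext i; fin_cases i
  · simp [pairTau_zero]
  · simp [pairTau_one]

theorem pairTau_single_one (β δ : LineRing Fq) :
    pairTau β δ (Pi.single 1 1) = ![algebraMap (RatFunc Fq) (LineRing Fq) RatFunc.X * δ, 0] := by
  ext i; fin_cases i
  · simp [pairTau_zero]
  · simp [pairTau_one]

theorem lift_pairTau_sum (β δ : LineRing Fq) (s : Fin 2 → LineRing Fq) :
    Pullback.lift (pairTau β δ)
      (∑ i, s i • Pullback.mk (lineSigma Fq) (Pi.single i 1 : Fin 2 → LineRing Fq)) =
      ![s 0 + s 1 * (algebraMap (RatFunc Fq) (LineRing Fq) RatFunc.X * δ), s 0 * β] := by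
  rw [Fin.sum_univ_two, map_add, map_smul, map_smul, Pullback.lift_mk, Pullback.lift_mk,
    pairTau_single_zero, pairTau_single_one]
  ext i; fin_cases i <;> simp

theorem lift_pairTau_injective (h : IsCoordFactorization β δ) :
    Function.Injective (Pullback.lift (pairTau β δ)) := by
  rw [injective_iff_map_eq_zero]
  intro p hp
  obtain ⟨s, rfl⟩ := Pullback.exists_sum_smul_mk (span_range_single _) p
  rw [lift_pairTau_sum] at hp
  have h1 : s 0 * β = 0 := congrFun hp 1
  have h0 : s 0 + s 1 * (algebraMap (RatFunc Fq) (LineRing Fq) RatFunc.X * δ) = 0 := congrFun hp 0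
  have s0 : s 0 = 0 := (mul_right_mem_nonZeroDivisors_eq_zero_iff h.left_mem).1 h1
  have s1 : s 1 = 0 := by
    refine (mul_right_mem_nonZeroDivisors_eq_zero_iff h.symm.left_mem).1 ?_
    linear_combination algebraMap (RatFunc Fq) (LineRing Fq) RatFunc.X⁻¹ * (h0 - s0) -
      s 1 * δ * algebraMap_X_mul_algebraMap_inv (Fq := Fq)
  rw [Fin.sum_univ_two, s0, s1, zero_smul, zero_smul, add_zero]

/-- The linear form `x 1 - β x 0` eliminates `s 0` from the image vector and leaves `-γ t (s 1)`. It
identifies the cokernel with `A_L/(t)`, which yields its dimension and its annihilator. -/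
theorem mem_range_lift_pairTau_iff (h : IsCoordFactorization β δ) (x : Fin 2 → LineRing Fq) :
    x ∈ LinearMap.range (Pullback.lift (pairTau β δ)) ↔
      ∃ w, x 1 - β * x 0 = lineCoord Fq * w := by
  have hγ := algebraMap_X_mul_algebraMap_inv (Fq := Fq)
  have hm := h.mul_eq
  set γ := algebraMap (RatFunc Fq) (LineRing Fq) RatFunc.X
  set γ' := algebraMap (RatFunc Fq) (LineRing Fq) RatFunc.X⁻¹
  constructor
  · rintro ⟨p, rfl⟩
    obtain ⟨s, rfl⟩ := Pullback.exists_sum_smul_mk (span_range_single _) p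
    rw [lift_pairTau_sum]
    refine ⟨-(s 1 * γ), ?_⟩
    change s 0 * β - β * (s 0 + s 1 * (γ * δ)) = _
    linear_combination -(s 1 * γ) * hm
  · rintro ⟨w, hw⟩
    refine ⟨∑ i, (![x 0 + δ * w, -(γ' * w)] : Fin 2 → LineRing Fq) i •
      Pullback.mk (lineSigma Fq) (Pi.single i 1 : Fin 2 → LineRing Fq), ?_⟩
    rw [lift_pairTau_sum]
    ext i; fin_cases i
    · change x 0 + δ * w + -(γ' * w) * (γ * δ) = x 0
      linear_combination -(w * δ) * hγ
    · change (x 0 + δ * w) * β = x 1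
      linear_combination w * hm - hw

theorem cokerDim_lift_pairTau (h : IsCoordFactorization β δ) :
    cokerDim (inftyPoint Fq) (Pullback.lift (pairTau β δ)) = (1 : ℕ) := by
  unfold cokerDim
  let : Module (RatFunc Fq) ((Fin 2 → LineRing Fq) ⧸
      LinearMap.range (Pullback.lift (pairTau β δ))) :=
    Module.compHom _ (algebraMap (RatFunc Fq) (LineRing Fq))
  rw [Nat.cast_one]
  refine Module.rank_eq_one_iff_finrank_eq_one.2 (finrank_eq_one
    (Submodule.Quotient.mk (Pi.single 1 1)) (fun h0 => ?_) fun k => ?_)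
  · rw [Submodule.Quotient.mk_eq_zero, mem_range_lift_pairTau_iff h] at h0
    obtain ⟨w, hw⟩ := h0
    have := congrArg (evalZero Fq) hw
    rw [map_mul, evalZero_lineCoord] at this
    simp at this
  · obtain ⟨x, rfl⟩ := Submodule.Quotient.mk_surjective _ k
    obtain ⟨y, hy⟩ := exists_eq_evalZero_add (x 1 - β * x 0)
    refine ⟨evalZero Fq (x 1 - β * x 0), ?_⟩
    refine (Submodule.Quotient.eq _ (x := algebraMap _ (LineRing Fq)
      (evalZero Fq (x 1 - β * x 0)) • (Pi.single 1 1 : Fin 2 → LineRing Fq))).2 ?_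
    rw [mem_range_lift_pairTau_iff h]
    refine ⟨-y, ?_⟩
    simp only [Pi.sub_apply, Pi.smul_apply, Pi.single_eq_same, smul_eq_mul, mul_one, ne_eq,
      zero_ne_one, not_false_eq_true, Pi.single_eq_of_ne, mul_zero]
    linear_combination -hy

theorem charIdeal_pow_le_annihilator (h : IsCoordFactorization β δ) :
    charIdeal (inftyPoint Fq) (zeroCharacteristic Fq) ^ 1 ≤ Module.annihilator (LineRing Fq)
      ((Fin 2 → LineRing Fq) ⧸ LinearMap.range (Pullback.lift (pairTau β δ))) := by
  rw [pow_one]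
  refine charIdeal_zeroCharacteristic_le.trans ((Ideal.span_singleton_le_iff_mem _).2 ?_)
  rw [Module.mem_annihilator]
  intro k
  obtain ⟨x, rfl⟩ := Submodule.Quotient.mk_surjective _ k
  rw [← Submodule.Quotient.mk_smul, Submodule.Quotient.mk_eq_zero, mem_range_lift_pairTau_iff h]
  exact ⟨x 1 - β * x 0, by simp only [Pi.smul_apply, smul_eq_mul]; ring⟩

theorem algebraMap_algebraMap_mem_stalk (x : RatFunc Fq) :
    algebraMap (LineRing Fq) (CurveField Fq (RatFunc Fq) (RatFunc Fq))
      (algebraMap _ (LineRing Fq) x) ∈ (inftyPoint Fq).stalk (RatFunc Fq) :=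
  (inftyPoint Fq).toCurveField_mem_stalk ((1 : (inftyPoint Fq).localRing) ⊗ₜ x)

/-- For `z = t⁻¹` the matrix of `z τ²` in the standard basis has rows `(γ + z, γ^q z δ)` and `(z β,
γ^q)`. Its entries are regular at `∞`, and since `z β δ = 1` its determinant is the constant
`γ^(q+1)`, a unit. -/
theorem isPure_lift_pairTau (h : IsCoordFactorization β δ) :
    IsPure (inftyPoint Fq) 2 (Pullback.lift (pairTau β δ)) := by
  rw [isPure_iff]
  let K := CurveField Fq (RatFunc Fq) (RatFunc Fq)
  let b : Module.Basis (Fin 2) K (K ⊗[LineRing Fq] (Fin 2 → LineRing Fq)) :=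
    Algebra.TensorProduct.basis K (Pi.basisFun (LineRing Fq) (Fin 2))
  have hb : ∀ i, b i = 1 ⊗ₜ Pi.single i 1 := fun i => by
    rw [Algebra.TensorProduct.basis_apply, Pi.basisFun_apply]
  have hone : ∀ m : Fin 2 → LineRing Fq,
      (1 : K) ⊗ₜ[LineRing Fq] m = algebraMap _ K (m 0) • b 0 + algebraMap _ K (m 1) • b 1 := by
    intro m
    have hm : m = m 0 • Pi.single 0 1 + m 1 • Pi.single 1 1 := by
      ext i; fin_cases i <;> simp
    conv_lhs => rw [hm]
    rw [TensorProduct.tmul_add, ← TensorProduct.smul_tmul, ← TensorProduct.smul_tmul, hb, hb,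
      TensorProduct.smul_tmul', TensorProduct.smul_tmul', Algebra.smul_def, Algebra.smul_def,
      smul_eq_mul, smul_eq_mul]
  have hT : ∀ i, genericTau (inftyPoint Fq) (Pullback.lift (pairTau β δ))
      (genericTau (inftyPoint Fq) (Pullback.lift (pairTau β δ)) (b i)) =
      1 ⊗ₜ[LineRing Fq] pairTau β δ (pairTau β δ (Pi.single i 1)) := fun i => by
    rw [hb]
    refine (genericTau_iterate_tmul 2 _).trans ?_
    congr 1
    change Pullback.lift _ (Pullback.mk _ (Pullback.lift _ (Pullback.mk _ _))) = _
    rw [Pullback.lift_mk, Pullback.lift_mk]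
  set γ := algebraMap (RatFunc Fq) (LineRing Fq) RatFunc.X with hγ
  set γ' := algebraMap (RatFunc Fq) (LineRing Fq) RatFunc.X⁻¹ with hγ'
  have hγγ : algebraMap _ K γ * algebraMap _ K γ' = 1 := by
    rw [← map_mul, algebraMap_X_mul_algebraMap_inv, map_one]
  have hσγγ : algebraMap _ K (lineSigma Fq γ) * algebraMap _ K (lineSigma Fq γ') = 1 := by
    rw [← map_mul, ← map_mul, algebraMap_X_mul_algebraMap_inv, map_one, map_one]
  have hσ : ∀ x : RatFunc Fq, algebraMap _ K (lineSigma Fq (algebraMap _ (LineRing Fq) x)) ∈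
      (inftyPoint Fq).stalk (RatFunc Fq) := fun x => by
    rw [algebraMap_lineRing, lineSigma_lineTmul, ← algebraMap_lineRing]
    exact algebraMap_algebraMap_mem_stalk _
  have hT0 : pairTau β δ (pairTau β δ (Pi.single 0 1)) = ![1 + γ * δ * β, β] := by
    rw [pairTau_single_zero]
    ext i; fin_cases i
    · change lineSigma Fq 1 + γ * δ * lineSigma Fq β = 1 + γ * δ * β
      rw [map_one, h.sigma_left]
    · change β * lineSigma Fq 1 = β
      rw [map_one, mul_one]
  have hT1 : pairTau β δ (pairTau β δ (Pi.single 1 1)) =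
      ![lineSigma Fq γ * δ, lineSigma Fq γ * lineCoord Fq] := by
    rw [pairTau_single_one, ← h.mul_eq]
    ext i; fin_cases i
    · change lineSigma Fq (γ * δ) + γ * δ * lineSigma Fq 0 = lineSigma Fq γ * δ
      rw [map_zero, mul_zero, add_zero, map_mul, h.sigma_right]
    · change β * lineSigma Fq (γ * δ) = lineSigma Fq γ * (β * δ)
      rw [map_mul, h.sigma_right]; ring
  let St := (inftyPoint Fq).stalk (RatFunc Fq)
  let Z : K := ofFunction Fq (RatFunc Fq) RatFunc.X⁻¹
  have hZ : Z ∈ St := (inftyPoint Fq).ofFunction_mem_stalk inv_X_mem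
  have hZt : Z * (algebraMap _ K β * algebraMap _ K δ) = 1 := by
    rw [← map_mul, h.mul_eq]; exact ofFunction_inv_mul_lineCoord
  have hZt' : Z * algebraMap _ K (lineCoord Fq) = 1 := ofFunction_inv_mul_lineCoord
  let G : St := ⟨_, algebraMap_algebraMap_mem_stalk RatFunc.X⟩
  let G' : St := ⟨_, algebraMap_algebraMap_mem_stalk RatFunc.X⁻¹⟩
  let S : St := ⟨_, hσ RatFunc.X⟩
  let S' : St := ⟨_, hσ RatFunc.X⁻¹⟩
  refine isPureEndomorphism_of_sq (inftyPoint Fq) (inv_ne_zero RatFunc.X_ne_zero)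
    inv_X_isUniformizer.1 inv_X_isUniformizer.2 _ b (G + ⟨Z, hZ⟩) (S * ⟨_, h.stalk_right⟩)
    ⟨_, h.stalk_left⟩ S (G' * S') ?_ ?_ (Subtype.val_injective ?_)
  · rw [hT, hT0, hone, smul_add, smul_smul, smul_smul]
    change (Z * algebraMap _ K (1 + γ * δ * β)) • b 0 + (Z * algebraMap _ K β) • b 1 =
      (algebraMap _ K γ + Z) • b 0 + (Z * algebraMap _ K β) • b 1
    congr 2
    rw [map_add, map_one, map_mul, map_mul]
    linear_combination algebraMap _ K γ * hZt
  · rw [hT, hT1, hone, smul_add, smul_smul, smul_smul]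
    change (Z * algebraMap _ K (lineSigma Fq γ * δ)) • b 0 +
      (Z * algebraMap _ K (lineSigma Fq γ * lineCoord Fq)) • b 1 =
      (algebraMap _ K (lineSigma Fq γ) * (Z * algebraMap _ K δ)) • b 0 +
      algebraMap _ K (lineSigma Fq γ) • b 1
    congr 2
    · rw [map_mul]; ring
    · rw [map_mul]; linear_combination algebraMap _ K (lineSigma Fq γ) * hZt'
  · change algebraMap _ K γ' * algebraMap _ K (lineSigma Fq γ') *
      ((algebraMap _ K γ + Z) * algebraMap _ K (lineSigma Fq γ) -
        algebraMap _ K (lineSigma Fq γ) * (Z * algebraMap _ K δ) * (Z * algebraMap _ K β)) = 1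
    generalize algebraMap _ K γ' = g', algebraMap _ K (lineSigma Fq γ') = s',
      algebraMap _ K γ = g, algebraMap _ K (lineSigma Fq γ) = s, algebraMap _ K δ = d,
      algebraMap _ K β = e at *
    linear_combination (g' * g) * hσγγ + hγγ - g' * s' * s * Z * hZt

/-- The pure Anderson motive `e₁ ↦ e₁ + β e₂`, `e₂ ↦ γ δ e₁` of rank two and dimension one. -/
def pairMotive (h : IsCoordFactorization β δ) :
    PureAndersonMotive (inftyPoint Fq) (zeroCharacteristic Fq) where
  M := Fin 2 → LineRing Fq
  r := 2
  d := 1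
  finite := inferInstance
  projective := inferInstance
  rank_eq p := by
    have : Nontrivial (LineRing Fq) := (evalZero Fq).domain_nontrivial
    rw [Module.rankAtStalk_eq_finrank_of_free]
    simp
  τ := Pullback.lift (pairTau β δ)
  injective := lift_pairTau_injective h
  coker_dim := cokerDim_lift_pairTau h
  coker_ann := charIdeal_pow_le_annihilator h
  pure := isPure_lift_pairTau h

theorem pairMotive_semilinearTau (h : IsCoordFactorization β δ) (x : Fin 2 → LineRing Fq) :
    (pairMotive h).semilinearTau x = pairTau β δ x :=
  Pullback.lift_mk _ x

end RankTwoMotives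

/-! ### A separable isogeny that cannot be reversed -/

section Asymmetry

open nonZeroDivisors

variable (Fq : Type u) [Field Fq] [Fintype Fq]

/-- The motive `e₁ ↦ e₁ + t e₂`, `e₂ ↦ γ e₁`. -/
def subMotive : PureAndersonMotive (inftyPoint Fq) (zeroCharacteristic Fq) :=
  pairMotive isCoordFactorization_one_lineCoord.symm

/-- The motive `e₁ ↦ e₁ + e₂`, `e₂ ↦ γ t e₁`. -/
def superMotive : PureAndersonMotive (inftyPoint Fq) (zeroCharacteristic Fq) :=
  pairMotive isCoordFactorization_one_lineCoord

/-- The linear map `e₁ ↦ t e₁`, `e₂ ↦ e₂`. -/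
def scaleFirst : (Fin 2 → LineRing Fq) →ₗ[LineRing Fq] (Fin 2 → LineRing Fq) where
  toFun v := ![lineCoord Fq * v 0, v 1]
  map_add' v w := by
    ext i; fin_cases i
    · simp; ring
    · simp
  map_smul' s v := by
    ext i; fin_cases i
    · simp; ring
    · simp

/-- The inclusion of `subMotive` in `superMotive`. -/
def subMotiveHom : MotiveHom (subMotive Fq) (superMotive Fq) :=
  MotiveHom.ofSemilinear (X := subMotive Fq) (Y := superMotive Fq) (scaleFirst Fq) fun x => by
    refine (congrArg (scaleFirst Fq) (pairMotive_semilinearTau _ x)).trans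
      (Eq.trans ?_ (pairMotive_semilinearTau _ _).symm)
    have ht := lineSigma_lineCoord (Fq := Fq)
    have hm := map_mul (lineSigma Fq) (lineCoord Fq) (x 0)
    ext i; fin_cases i
    · change lineCoord Fq * (lineSigma Fq (x 0) +
        algebraMap (RatFunc Fq) (LineRing Fq) RatFunc.X * 1 * lineSigma Fq (x 1)) =
        lineSigma Fq (lineCoord Fq * x 0) +
        algebraMap (RatFunc Fq) (LineRing Fq) RatFunc.X * lineCoord Fq * lineSigma Fq (x 1)
      rw [hm, ht]; ring
    · change lineCoord Fq * lineSigma Fq (x 0) = 1 * lineSigma Fq (lineCoord Fq * x 0)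
      rw [hm, ht, one_mul]

theorem mem_range_scaleFirst_iff (y : Fin 2 → LineRing Fq) :
    y ∈ LinearMap.range (scaleFirst Fq) ↔ ∃ w, y 0 = lineCoord Fq * w := by
  constructor
  · rintro ⟨x, rfl⟩
    exact ⟨x 0, rfl⟩
  · rintro ⟨w, hw⟩
    refine ⟨![w, y 1], ?_⟩
    ext i; fin_cases i
    · exact hw.symm
    · rfl

/-- The cokernel is `A_L/(t)`, generated by the class `k` of the first basis vector. The second
basis vector lies in the image, so `τ` fixes `k`. As `σ` is not bijective here, the linearization is
treated directly. -/
theorem separablyIsogenous_subMotive_superMotive :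
    SeparablyIsogenous (subMotive Fq) (superMotive Fq) := by
  let f := subMotiveHom Fq
  have hrange : ∀ y : Fin 2 → LineRing Fq,
      y ∈ LinearMap.range f.hom ↔ ∃ w, y 0 = lineCoord Fq * w := mem_range_scaleFirst_iff Fq
  refine ⟨f, ⟨?_, ?_⟩, ?_⟩
  · intro x y hxy
    have h : scaleFirst Fq x = scaleFirst Fq y := hxy
    funext i; fin_cases i
    · exact (mul_cancel_left_mem_nonZeroDivisors lineCoord_mem_nonZeroDivisors).1 (congrFun h 0)
    · exact congrFun h 1
  · rw [MotiveHom.isTorsion_coker_iff]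
    exact fun y => ⟨lineCoord Fq, lineCoord_mem_nonZeroDivisors, (hrange _).2 ⟨y 0, rfl⟩⟩
  obtain ⟨φ, hφ, hφ'⟩ := f.cokerTau_eq_lift
  let e : (superMotive Fq).M := (Pi.single 0 1 : Fin 2 → LineRing Fq)
  let k : (superMotive Fq).M ⧸ LinearMap.range f.hom := Submodule.Quotient.mk e
  have hk : ∀ y : Fin 2 → LineRing Fq,
      (Submodule.Quotient.mk y : (superMotive Fq).M ⧸ LinearMap.range f.hom) = y 0 • k := by
    intro y
    refine (Submodule.Quotient.eq _ (x := y)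
      (y := y 0 • (Pi.single 0 1 : Fin 2 → LineRing Fq))).2 ((hrange _).2 ⟨0, ?_⟩)
    simp
  have hφk : φ k = k := by
    have he : (superMotive Fq).semilinearTau e = pairTau 1 (lineCoord Fq) (Pi.single 0 1) :=
      pairMotive_semilinearTau _ _
    refine (hφ' e).trans ((congrArg (Submodule.Quotient.mk (p := LinearMap.range f.hom)) he).trans
      ((hk _).trans ?_))
    rw [pairTau_single_zero]
    exact one_smul _ k
  have hspan : Submodule.span (LineRing Fq) (Set.range fun _ : Fin 1 => k) = ⊤ := by
    rw [Set.range_const]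
    refine Submodule.eq_top_iff'.2 fun x => ?_
    obtain ⟨y, rfl⟩ := Submodule.Quotient.mk_surjective _ x
    exact Submodule.mem_span_singleton.2 ⟨_, (hk y).symm⟩
  rw [hφ]
  constructor
  · rw [injective_iff_map_eq_zero]
    intro p hp
    obtain ⟨s, rfl⟩ := Pullback.exists_sum_smul_mk hspan p
    rw [Fin.sum_univ_one] at hp ⊢
    rw [map_smul, Pullback.lift_mk, hφk] at hp
    have h1 : s 0 • (Pi.single 0 1 : Fin 2 → LineRing Fq) ∈ LinearMap.range f.hom :=
      (Submodule.Quotient.mk_eq_zero _).1 hp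
    obtain ⟨w, hw⟩ := (hrange _).1 h1
    have hw' : s 0 = w * lineCoord Fq := by simpa [mul_comm] using hw
    have h2 : lineCoord Fq • k = 0 :=
      (Submodule.Quotient.mk_eq_zero _).2
        ((hrange (lineCoord Fq • (Pi.single 0 1 : Fin 2 → LineRing Fq))).2 ⟨1, by simp⟩)
    -- Since `σ(t) = t`, the factor `t` of `s 0` moves across the tensor sign, where it kills `k`.
    rw [hw', mul_smul]
    conv_lhs => rw [← lineSigma_lineCoord]
    rw [← Pullback.mk_smul, h2, map_zero, smul_zero]
  · intro x
    obtain ⟨y, rfl⟩ := Submodule.Quotient.mk_surjective _ x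
    exact ⟨(show Fin 2 → LineRing Fq from y) 0 • Pullback.mk _ k, by
      rw [map_smul, Pullback.lift_mk, hφk]; exact (hk y).symm⟩

/-- Modulo `t`, the image of a morphism from `superMotive` to `subMotive` lies in the étale line
generated by the first basis vector. -/
theorem evalZero_hom_one (h : MotiveHom (superMotive Fq) (subMotive Fq))
    (y : (superMotive Fq).M) :
    evalZero Fq ((show Fin 2 → LineRing Fq from h.hom y) 1) = 0 := by
  let g : (Fin 2 → LineRing Fq) →ₗ[LineRing Fq] (Fin 2 → LineRing Fq) := h.hom
  have hg : ∀ x, g (pairTau 1 (lineCoord Fq) x) = pairTau (lineCoord Fq) 1 (g x) := fun x => by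
    refine ((congrArg g (pairMotive_semilinearTau _ x)).symm.trans
      (h.hom_semilinearTau x)).trans (pairMotive_semilinearTau _ _)
  let e₀ : Fin 2 → LineRing Fq := Pi.single 0 1
  let e₁ : Fin 2 → LineRing Fq := Pi.single 1 1
  have hT1 : pairTau 1 (lineCoord Fq) e₁ =
      lineCoord Fq • (algebraMap (RatFunc Fq) (LineRing Fq) RatFunc.X • e₀) := by
    rw [pairTau_single_one]
    ext i; fin_cases i
    · change _ * lineCoord Fq = lineCoord Fq * (_ * (Pi.single 0 1 : Fin 2 → LineRing Fq) 0)
      rw [Pi.single_eq_same, mul_one, mul_comm]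
    · simp [e₀]
  have hT0 : pairTau 1 (lineCoord Fq) e₀ = e₀ + e₁ := by
    rw [pairTau_single_zero]
    ext i; fin_cases i <;> simp [e₀, e₁]
  -- Modulo `t`, `τ e₁ = 0` in `superMotive`. If `(a, b)` is the reduction of `g e₁`, the first
  -- coordinate of `τ (g e₁)` reads `a^q + γ b^q = 0`.
  have h1 := congrFun (hg e₁) 0
  rw [hT1, map_smul, pairTau_zero, Pi.smul_apply, smul_eq_mul, mul_one] at h1
  have h2 := congrArg (evalZero Fq) h1
  rw [map_mul, evalZero_lineCoord, zero_mul, map_add, map_mul, evalZero_lineSigma,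
    evalZero_lineSigma, evalZero_algebraMap] at h2
  have hd : evalZero Fq (g e₁ 1) = 0 := eq_zero_of_pow_add_X_mul_pow_eq_zero h2.symm
  -- The second coordinate of `τ (g e₀) = g e₀ + g e₁` is divisible by `t`, and that of `g e₁`
  -- vanishes modulo `t` by `hd`.
  have h3 := congrArg (evalZero Fq) (congrFun (hg e₀) 1)
  rw [hT0, map_add, pairTau_one, Pi.add_apply, map_add, hd, add_zero, map_mul, evalZero_lineCoord,
    zero_mul] at h3
  have hy : ∀ y : Fin 2 → LineRing Fq, y = y 0 • e₀ + y 1 • e₁ := fun y => by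
    ext i; fin_cases i <;> simp [e₀, e₁]
  change evalZero Fq (g y 1) = 0
  rw [hy y, map_add, map_smul, map_smul, Pi.add_apply, Pi.smul_apply, Pi.smul_apply, smul_eq_mul,
    smul_eq_mul, map_add, map_mul, map_mul, h3, hd, mul_zero, mul_zero, add_zero]

/-- Modulo `t`, the second coordinate vanishes both on the image of `τ` and on the image of any
morphism, so the class of the second basis vector is not reached by `τ` on the cokernel. -/
theorem not_separablyIsogenous_superMotive_subMotive :
    ¬ SeparablyIsogenous (superMotive Fq) (subMotive Fq) := by
  rintro ⟨h, -, -, hsurj⟩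
  obtain ⟨φ, hφ, hφ'⟩ := h.cokerTau_eq_lift
  rw [hφ] at hsurj
  have key : ∀ p, ∃ x : Fin 2 → LineRing Fq, evalZero Fq (x 1) = 0 ∧
      Pullback.lift φ p = Submodule.Quotient.mk (p := LinearMap.range h.hom) x := by
    intro p
    induction p using Pullback.induction with
    | h0 => exact ⟨0, map_zero _, map_zero _⟩
    | ht a m =>
      obtain ⟨m, rfl⟩ := Submodule.Quotient.mk_surjective _ m
      refine ⟨a • pairTau (lineCoord Fq) 1 m, ?_, ?_⟩
      · change evalZero Fq (a * (lineCoord Fq *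
          lineSigma Fq ((show Fin 2 → LineRing Fq from m) 0))) = 0
        rw [map_mul, map_mul, evalZero_lineCoord, zero_mul, mul_zero]
      · rw [Pullback.lift_tmul, hφ']
        exact congrArg (a • Submodule.Quotient.mk (p := LinearMap.range h.hom) ·)
          (pairMotive_semilinearTau _ m)
    | ha x y hx hy =>
      obtain ⟨x', hx0, hx⟩ := hx
      obtain ⟨y', hy0, hy⟩ := hy
      refine ⟨x' + y', by rw [Pi.add_apply, map_add, hx0, hy0, add_zero], ?_⟩
      rw [map_add, hx, hy]
      rfl
  obtain ⟨p, hp⟩ := hsurj (Submodule.Quotient.mk (Pi.single 1 1 : Fin 2 → LineRing Fq))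
  obtain ⟨x, hx0, hx⟩ := key p
  obtain ⟨y, hy⟩ := (Submodule.Quotient.eq _).1 (hx.symm.trans hp)
  have h0 := evalZero_hom_one Fq h y
  rw [hy] at h0
  have h1 : evalZero Fq (x 1 - (Pi.single 1 1 : Fin 2 → LineRing Fq) 1) = 0 := h0
  rw [map_sub, hx0, Pi.single_eq_same, map_one, zero_sub, neg_eq_zero] at h1
  exact one_ne_zero h1

end Asymmetry

end

theorem mainTheorem5 :
    (∀ (Fq Q L : Type u) [Field Fq] [Fintype Fq] [Field Q] [Algebra Fq Q] [Field L] [Algebra Fq L]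
      [Finite L], IsCurveFunctionField Fq Q →
      ∀ (P : RationalPoint Fq Q) (c : P.affineRing →ₐ[Fq] L),
        Equivalence (SeparablyIsogenous : PureAndersonMotive P c → PureAndersonMotive P c → Prop)) ∧
    (∀ (Fq : Type u) [Field Fq] [Fintype Fq],
      ∃ (P : RationalPoint Fq (RatFunc Fq)) (c : P.affineRing →ₐ[Fq] RatFunc Fq),
        (RatFunc.X : RatFunc Fq) ∉ P.valuationRing ∧
        (∀ a : P.affineRing, (a : RatFunc Fq) = RatFunc.X → c a = 0) ∧
        ∃ X Y : PureAndersonMotive P c, SeparablyIsogenous X Y ∧ ¬ SeparablyIsogenous Y X) := by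
  refine ⟨?_, ?_⟩
  · intro Fq Q L _ _ _ _ _ _ _ hC P c
    exact ⟨SeparablyIsogenous.refl, SeparablyIsogenous.symm hC, SeparablyIsogenous.trans⟩
  · intro Fq _ _
    refine ⟨inftyPoint Fq, zeroCharacteristic Fq, X_notMem_inftyValuationRing, fun a ha => ?_,
      subMotive Fq, superMotive Fq, separablyIsogenous_subMotive_superMotive Fq,
      not_separablyIsogenous_superMotive_subMotive Fq⟩
    have h : a = affineRingEquiv Polynomial.X := Subtype.val_injective (by
      rw [ha, coe_affineRingEquiv, RatFunc.algebraMap_X])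
    rw [h, zeroCharacteristic_affineRingEquiv, Polynomial.coeff_X_zero, map_zero]
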